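/- Let $k$ be a field, $Q$ a finite quiver with vertices $1,\dots,n$, $I\subseteq kQ$ an admissible ideal generated by a set of paths of length at least two, and $A=kQ/I$. (Paths are composed from right to left: $pq$ means first $q$, then $p$. Modules are finite-dimensional left modules. A path in $A$ is a class $p+I$ of a path $p\notin I$.) Write $e_i$ for the idempotent of $A$ given by the trivial path at $i$, $L=\bigoplus_i k e_i$ for the span of the trivial paths, $P_i^A=Ae_i$, $L_i^A=P_i^A/\operatorname{rad}P_i^A$, and order the simple modules by $L_i^A\le_A L_j^A\Leftrightarrow i\le j$. Let $\Delta_i^A$ be the maximal factor module of $P_i^A$ with $[\Delta_i^A:L_j^A]=0$ for all $j>i$. Assume that $(A,\le_A)$ is quasi-hereditary, that is, $A$ has a finite filtration by left submodules whose subquotients are standard modules $\Delta_i^A$, and $\operatorname{End}_A(\Delta_i^A)\cong k$ for all $i$. The opposite algebra $A^{\mathrm{op}}$ is considered with the same paths, idempotents and order of the indices. For $R\in\{A,A^{\mathrm{op}}\}$, a path in $e_jRe_i$ is direction-preserving if $i<j$; $B_{\max}(R)$ is the subalgebra generated by $L$ and all direction-preserving paths in $R$; an element $x\in R$ is right-minimal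 direction-preserving if $x\in B_{\max}(R)$ and $x\notin\operatorname{rad}(R)\operatorname{rad}(B_{\max}(R))$; and $B_{\min}(R)$ is the subalgebra of $R$ generated by all right-minimal direction-preserving paths (the trivial paths are among them). Put $B_{\min}=B_{\min}(A)$ and $C_{\min}=B_{\min}(A^{\mathrm{op}})$. A subalgebra $B\subseteq R$ is an exact Borel subalgebra if the functor $R\otimes_B-$ is exact and the simple $B$-modules can be listed without repetition up to isomorphism as $L_1^B,\dots,L_n^B$ such that, for all $i,j$: $R\otimes_B L_i^B\cong\Delta_i^R$; $\operatorname{End}_B(L_i^B)\cong\operatorname{End}_R(L_i^R)$; and $\operatorname{Ext}^1_B(L_i^B,L_j^B)\ne0$ implies $i\le j$. Dually, a subalgebra $C\subseteq A$ is a $\Delta$-subalgebra if the simple $C$-modules can be listed without repetition up to isomorphism as $L_1^C,\dots,L_n^C$ such that, for all $i,j$: $\operatorname{End}_C(L_i^C)\cong\operatorname{End}_A(L_i^A)$; $\operatorname{Ext}^1_C(L_i^C,L_j^C)\neq0$ implies $j\le i$; and the restriction of $\Delta_i^A$ to $C$ is a projective cover of $L_i^C$ (equivalently, it is the $i$-th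 standard module of $C$). **Theorem.** Under these assumptions, $C_{\min}$ is an exact Borel subalgebra of $(A^{\mathrm{op}},\le_A)$, $C_{\min}^{\mathrm{op}}$ is a $\Delta$-subalgebra of $(A,\le_A)$, and there is a Reedy decomposition: $B_{\min}$ is an exact Borel subalgebra of $(A,\le_A)$, both $C_{\min}^{\mathrm{op}}$ and $B_{\min}$ contain $L$, and the multiplication map $$C_{\min}^{\mathrm{op}}\otimes_L B_{\min}\to A,\qquad c\otimes b\mapsto cb,$$ is an isomorphism. -/

import Mathlib

open scoped TensorProduct

universe u v w

noncomputable section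

namespace QHMonomial

/-! ### Path algebras of quivers -/

/-- A path in a quiver, together with its source and its target. -/
@[ext]
structure QPath (V : Type v) [Quiver.{w} V] where
  src : V
  tgt : V
  path : Quiver.Path src tgt

namespace QPath

variable {V : Type v} [Quiver.{w} V]

/-- The trivial path at a vertex. -/
def trivial (a : V) : QPath V := ⟨a, a, Quiver.Path.nil⟩

/-- The length (number of arrows) of a path. -/
def length (p : QPath V) : ℕ := p.path.length

/-- The composite `p q` of two paths with `s(p) = t(q)`: first `q`, then `p`. -/
def comp (p q : QPath V) (h : q.tgt = p.src) : QPath V :=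
  ⟨q.src, p.tgt, q.path.comp (p.path.cast h.symm rfl)⟩

theorem comp_assoc (p q r : QPath V) (h₁ : q.tgt = p.src) (h₂ : r.tgt = q.src) :
    (p.comp q h₁).comp r h₂ = p.comp (q.comp r h₂) h₁ := by
  obtain ⟨a, b, p⟩ := p
  obtain ⟨c, d, q⟩ := q
  obtain ⟨e, f, r⟩ := r
  dsimp only at h₁ h₂
  subst h₁ h₂
  simp [comp]

theorem trivial_comp (p : QPath V) : (trivial p.tgt).comp p rfl = p := by
  simp [comp, trivial]

theorem comp_trivial (p : QPath V) : p.comp (trivial p.src) rfl = p := by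
  simp [comp, trivial]

end QPath

/-- The underlying vector space of the path algebra `k V` of the quiver `V`: the vector space
with basis the paths of `V`, including the trivial ones. -/
def PathAlgebra (k : Type u) [Field k] (V : Type v) [Quiver.{w} V] : Type (max u v w) :=
  QPath V →₀ k

namespace PathAlgebra

variable (k : Type u) [Field k] {V : Type v} [Quiver.{w} V]

instance : AddCommGroup (PathAlgebra k V) := inferInstanceAs (AddCommGroup (QPath V →₀ k))

instance : Module k (PathAlgebra k V) := inferInstanceAs (Module k (QPath V →₀ k))

/-- A path, as an element of the path algebra. -/
def ofPath (p : QPath V) : PathAlgebra k V := Finsupp.single p (1 : k)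

open Classical in
/-- The product of two paths: their composite (first `q`, then `p`) if `s(p) = t(q)`,
and `0` otherwise. -/
def pathMul (p q : QPath V) : PathAlgebra k V :=
  if h : q.tgt = p.src then ofPath k (p.comp q h) else 0

/-- The multiplication of the path algebra: the bilinear extension of the product of paths. -/
def mulHom : PathAlgebra k V →ₗ[k] PathAlgebra k V →ₗ[k] PathAlgebra k V :=
  Finsupp.linearCombination k fun p =>
    (Finsupp.linearCombination k fun q => pathMul k p q : PathAlgebra k V →ₗ[k] PathAlgebra k V)

instance : Mul (PathAlgebra k V) := ⟨fun x y => mulHom k x y⟩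

instance [Fintype V] : One (PathAlgebra k V) := ⟨∑ a : V, ofPath k (QPath.trivial a)⟩

theorem mul_def (x y : PathAlgebra k V) : x * y = mulHom k x y := rfl

theorem one_def [Fintype V] :
    (1 : PathAlgebra k V) = ∑ a : V, ofPath k (QPath.trivial a) := rfl

theorem ofPath_mul_ofPath (p q : QPath V) : ofPath k p * ofPath k q = pathMul k p q := by
  rw [mul_def, mulHom, ofPath, ofPath]
  erw [Finsupp.linearCombination_single, one_smul, Finsupp.linearCombination_single, one_smul]

theorem hom_ext {M : Type*} [AddCommMonoid M] [Module k M] {f g : PathAlgebra k V →ₗ[k] M}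
    (h : ∀ p, f (ofPath k p) = g (ofPath k p)) : f = g :=
  Finsupp.lhom_ext' fun p => LinearMap.ext_ring (h p)

theorem pathMul_assoc (p q r : QPath V) :
    pathMul k p q * ofPath k r = ofPath k p * pathMul k q r := by
  unfold pathMul
  split_ifs with h₁ h₂ h₂
  · rw [ofPath_mul_ofPath, ofPath_mul_ofPath]
    unfold pathMul
    rw [dif_pos (show r.tgt = (p.comp q h₁).src from h₂),
      dif_pos (show (q.comp r h₂).tgt = p.src from h₁), QPath.comp_assoc]
  · rw [ofPath_mul_ofPath, pathMul, dif_neg (by exact h₂)]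
    simp [mul_def]
  · rw [ofPath_mul_ofPath, pathMul, dif_neg (by exact h₁)]
    simp [mul_def]
  · simp [mul_def]

theorem mul_assoc' (x y z : PathAlgebra k V) : x * y * z = x * (y * z) := by
  have h : (LinearMap.llcomp k _ _ _ (mulHom k (V := V))).comp (mulHom k) =
      (LinearMap.llcomp k _ _ _ |>.flip (mulHom k (V := V))).comp
        ((LinearMap.llcomp k _ _ _).comp (mulHom k (V := V))) := by
    refine hom_ext k fun p => hom_ext k fun q => hom_ext k fun r => ?_
    have := pathMul_assoc k p q r
    rw [← ofPath_mul_ofPath, ← ofPath_mul_ofPath] at this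
    exact this
  exact LinearMap.congr_fun (LinearMap.congr_fun (LinearMap.congr_fun h x) y) z

theorem one_mul' [Fintype V] (x : PathAlgebra k V) : 1 * x = x := by
  classical
  have h : mulHom k (1 : PathAlgebra k V) = LinearMap.id := by
    refine hom_ext k fun p => ?_
    have h1 : ∀ a : V, mulHom k (ofPath k (QPath.trivial a)) (ofPath k p) =
        if p.tgt = a then ofPath k p else 0 := by
      intro a
      change ofPath k (QPath.trivial a) * ofPath k p = _
      rw [ofPath_mul_ofPath, pathMul]
      split_ifs with h1 h2 h2
      · subst h2
        rw [QPath.trivial_comp]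
      · exact absurd h1 h2
      · exact absurd h2 h1
      · rfl
    rw [one_def, map_sum, LinearMap.sum_apply]
    simp [h1]
  exact LinearMap.congr_fun h x

theorem mul_one' [Fintype V] (x : PathAlgebra k V) : x * 1 = x := by
  classical
  have h : (mulHom k).flip (1 : PathAlgebra k V) = LinearMap.id := by
    refine hom_ext k fun p => ?_
    have h1 : ∀ a : V, mulHom k (ofPath k p) (ofPath k (QPath.trivial a)) =
        if a = p.src then ofPath k p else 0 := by
      intro a
      change ofPath k p * ofPath k (QPath.trivial a) = _
      rw [ofPath_mul_ofPath, pathMul]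
      split_ifs with h1 h2 h2
      · subst h2
        rw [QPath.comp_trivial]
      · exact absurd h1 h2
      · exact absurd h2 h1
      · rfl
    rw [LinearMap.flip_apply, one_def, map_sum]
    simp [h1]
  exact LinearMap.congr_fun h x

instance [Fintype V] : Ring (PathAlgebra k V) where
  __ := (inferInstance : AddCommGroup (PathAlgebra k V))
  left_distrib x y z := by simp [mul_def]
  right_distrib x y z := by simp [mul_def]
  zero_mul x := by simp [mul_def]
  mul_zero x := by simp [mul_def]
  mul_assoc := mul_assoc' k
  one_mul := one_mul' k
  mul_one := mul_one' k

instance [Fintype V] : Algebra k (PathAlgebra k V) :=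
  Algebra.ofModule (fun r x y => by simp [mul_def]) (fun r x y => by simp [mul_def])

end PathAlgebra

/-! ### Monomial algebras -/

section Monomial

variable (k : Type u) [Field k] {V : Type v} [Quiver.{w} V] [Fintype V]

/-- The monomial ideal of the path algebra generated by a set `X` of paths. -/
def monomialIdeal (X : Set (QPath V)) : TwoSidedIdeal (PathAlgebra k V) :=
  TwoSidedIdeal.span (PathAlgebra.ofPath k '' X)

/-- The set of paths `X` generates an admissible ideal `I` of the path algebra: all its elements
have length at least two, and `I` contains all sufficiently long paths. -/
def IsAdmissible (X : Set (QPath V)) : Prop :=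
  (∀ p ∈ X, 2 ≤ p.length) ∧
    ∃ N : ℕ, ∀ p : QPath V, N ≤ p.length → PathAlgebra.ofPath k p ∈ monomialIdeal k X

/-- The monomial algebra `A = k V / I`, where `I` is the ideal generated by the paths in `X`. -/
abbrev MonomialAlgebra (X : Set (QPath V)) : Type (max u v w) :=
  (monomialIdeal k X).ringCon.Quotient

/-- The class `p + I` of a path `p` in the monomial algebra. -/
def pathClass (X : Set (QPath V)) (p : QPath V) : MonomialAlgebra k X :=
  (monomialIdeal k X).ringCon.mkₐ k (PathAlgebra.ofPath k p)

/-- The idempotents `e_i + I` of the monomial algebra, where the vertices of the quiver are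
numbered by `ν`. -/
def vertexIdem (X : Set (QPath V)) {n : ℕ} (ν : Fin n ≃ V) (i : Fin n) : MonomialAlgebra k X :=
  pathClass k X (QPath.trivial (ν i))

/-- The paths in `A`: the classes `p + I` of the paths `p` that do not lie in `I`. -/
def pathsIn (X : Set (QPath V)) : Set (MonomialAlgebra k X) :=
  {x | ∃ p : QPath V, PathAlgebra.ofPath k p ∉ monomialIdeal k X ∧ x = pathClass k X p}

end Monomial

/-! ### Standard modules and quasi-hereditary algebras

In the following definitions `R` is a finite-dimensional basic algebra over the field `k`, and
`e 0, …, e (n - 1)` is a complete list of primitive orthogonal idempotents of `R`. It indexes the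
simple modules of `R`, which are ordered by the natural order of the indices. Modules are left
modules; right `R`-modules are modules over `Rᵐᵒᵖ`. -/

section Standard

variable (R : Type u) [Ring R] {n : ℕ} (e : Fin n → R)

/-- The projective module `P_i = R e_i`. -/
abbrev proj (i : Fin n) : Submodule R R := Submodule.span R {e i}

/-- The simple module `L_i = P_i / rad P_i`. -/
abbrev simple (i : Fin n) : Type u := proj R e i ⧸ Module.jacobson R (proj R e i)

/-- `S` is a composition factor of `M`, that is, `[M : S] ≠ 0` (for a simple module `S` and a
module `M` of finite length): `S` is isomorphic to a subquotient of `M`. -/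
def IsCompositionFactor (S : Type v) [AddCommGroup S] [Module R S]
    (M : Type w) [AddCommGroup M] [Module R M] : Prop :=
  ∃ N N' : Submodule R M, N ≤ N' ∧ Nonempty ((N' ⧸ N.submoduleOf N') ≃ₗ[R] S)

/-- The kernel of the projection from `P_i` to `Δ_i`: the smallest submodule `U` of `P_i` with
`[P_i / U : L_j] = 0` for all `j > i`. -/
def standardKernel (i : Fin n) : Submodule R (proj R e i) :=
  sInf {U | ∀ j, i < j → ¬ IsCompositionFactor R (simple R e j) (proj R e i ⧸ U)}

/-- The standard module `Δ_i`: the maximal factor module of `P_i` with `[Δ_i : L_j] = 0` for all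
`j > i`. -/
abbrev standard (i : Fin n) : Type u := proj R e i ⧸ standardKernel R e i

/-- `M` lies in `filt(Δ)`: it has a finite filtration whose subquotients are standard modules. -/
def IsStandardFiltered (M : Type w) [AddCommGroup M] [Module R M] : Prop :=
  ∃ (m : ℕ) (F : ℕ → Submodule R M), F 0 = ⊥ ∧ F m = ⊤ ∧
    ∀ t < m, F t ≤ F (t + 1) ∧
      ∃ i, Nonempty ((F (t + 1) ⧸ (F t).submoduleOf (F (t + 1))) ≃ₗ[R] standard R e i)

/-- `(R, ≤)` is quasi-hereditary: `R` has a filtration by standard modules, and the endomorphism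
algebras of the standard modules are isomorphic to the ground field. -/
structure IsQuasiHereditary (k : Type v) [Field k] [Algebra k R] : Prop where
  filtered : IsStandardFiltered R e R
  endStandard : ∀ i, Nonempty (Module.End R (standard R e i) ≃ₐ[k] k)

end Standard

/-! ### Induction -/

section Induction

variable {k : Type u} [Field k] {R : Type v} [Ring R] [Algebra k R] (B : Subalgebra k R)

section Obj

variable (M : Type w) [AddCommGroup M] [Module k M] [Module B M]

/-- The relations `(a b) ⊗ m = a ⊗ (b m)`, for `b ∈ B`, in `R ⊗_k M`. -/
def inducedRel : Submodule R (R ⊗[k] M) :=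
  Submodule.span R
    {x | ∃ (a : R) (b : B) (m : M), x = (a * (b : R)) ⊗ₜ[k] m - a ⊗ₜ[k] (b • m)}

/-- The induced left `R`-module `R ⊗_B M`. -/
abbrev Induced : Type (max v w) := (R ⊗[k] M) ⧸ inducedRel B M

end Obj

variable {M N : Type w} [AddCommGroup M] [Module k M] [Module B M] [IsScalarTower k B M]
  [AddCommGroup N] [Module k N] [Module B N] [IsScalarTower k B N]

/-- The map `R ⊗_B f : R ⊗_B M → R ⊗_B N`, `a ⊗ m ↦ a ⊗ f m`. -/
def inducedMap (f : M →ₗ[B] N) : Induced B M →ₗ[R] Induced B N :=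
  Submodule.mapQ (inducedRel B M) (inducedRel B N)
    (TensorProduct.AlgebraTensorModule.lTensor R R (f.restrictScalars k)) <| by
      refine Submodule.span_le.2 ?_
      rintro _ ⟨a, b, m, rfl⟩
      refine Submodule.subset_span ⟨a, b, f m, ?_⟩
      simp

end Induction

/-! ### Exact Borel subalgebras and `Δ`-subalgebras -/

section Borel

/-- `S` is a complete list without repetitions of the simple `R`-modules up to isomorphism. -/
structure IsSimpleList (R : Type u) [Ring R] {n : ℕ} (S : Fin n → Type u)
    [∀ i, AddCommGroup (S i)] [∀ i, Module R (S i)] : Prop where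
  isSimple : ∀ i, IsSimpleModule R (S i)
  injective : ∀ i j, Nonempty (S i ≃ₗ[R] S j) → i = j
  surjective : ∀ (M : Type u) [AddCommGroup M] [Module R M], IsSimpleModule R M →
    ∃ i, Nonempty (M ≃ₗ[R] S i)

variable {k : Type v} [Field k] {R : Type u} [Ring R] [Algebra k R] {n : ℕ} (e : Fin n → R)

/-- The conditions on an exact Borel subalgebra `B` of `R`, where the bijection `φ` between the
simple `B`-modules and the simple `R`-modules is given by a list `S` of the simple `B`-modules,
as `φ (S i) = L_i`. -/
structure IsExactBorelVia (B : Subalgebra k R) (S : Fin n → Type u) [∀ i, AddCommGroup (S i)]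
    [∀ i, Module k (S i)] [∀ i, Module B (S i)] [∀ i, IsScalarTower k B (S i)] : Prop where
  simples : IsSimpleList B S
  /-- The functor `R ⊗_B -` on finite-dimensional `B`-modules is exact. -/
  exact : ∀ (M N P : Type u) [AddCommGroup M] [Module k M] [Module B M] [IsScalarTower k B M]
    [AddCommGroup N] [Module k N] [Module B N] [IsScalarTower k B N]
    [AddCommGroup P] [Module k P] [Module B P] [IsScalarTower k B P]
    [Module.Finite k M] [Module.Finite k N] [Module.Finite k P]
    (f : M →ₗ[B] N) (g : N →ₗ[B] P), Function.Injective f → Function.Exact f g →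
    Function.Surjective g → Function.Injective (inducedMap B f) ∧
      Function.Exact (inducedMap B f) (inducedMap B g) ∧ Function.Surjective (inducedMap B g)
  induced : ∀ i, Nonempty (Induced B (S i) ≃ₗ[R] standard R e i)
  endSimple : ∀ i, Nonempty (Module.End B (S i) ≃ₐ[k] Module.End R (simple R e i))
  directed : ∀ i j, Nontrivial (CategoryTheory.Abelian.Ext (ModuleCat.of B (S i))
    (ModuleCat.of B (S j)) 1) → i ≤ j

/-- `B` is an exact Borel subalgebra of `(R, ≤)`. -/
def IsExactBorel (B : Subalgebra k R) : Prop :=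
  ∃ (S : Fin n → Type u) (_ : ∀ i, AddCommGroup (S i)) (_ : ∀ i, Module k (S i))
    (_ : ∀ i, Module B (S i)) (_ : ∀ i, IsScalarTower k B (S i)), IsExactBorelVia e B S

/-- `P` is a projective cover of `T`. -/
def IsProjectiveCover (R : Type u) [Ring R] (P T : Type w) [AddCommGroup P] [Module R P]
    [AddCommGroup T] [Module R T] : Prop :=
  Module.Projective R P ∧ ∃ π : P →ₗ[R] T, Function.Surjective π ∧
    ∀ N : Submodule R P, N ⊔ LinearMap.ker π = ⊤ → N = ⊤

/-- The conditions on a `Δ`-subalgebra `C` of `R`, with respect to a list `T` of the simple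
`C`-modules. By `directed`, the standard modules of `C` are its indecomposable projective modules,
so `restrict` says that the restriction of `Δ_i` to `C` is the `i`-th standard module of `C`. -/
structure IsDeltaSubalgebraVia (C : Subalgebra k R) (T : Fin n → Type u)
    [∀ i, AddCommGroup (T i)] [∀ i, Module k (T i)] [∀ i, Module C (T i)]
    [∀ i, IsScalarTower k C (T i)] : Prop where
  simples : IsSimpleList C T
  endSimple : ∀ i, Nonempty (Module.End C (T i) ≃ₐ[k] Module.End R (simple R e i))
  directed : ∀ i j, Nontrivial (CategoryTheory.Abelian.Ext (ModuleCat.of C (T i))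
    (ModuleCat.of C (T j)) 1) → j ≤ i
  restrict : ∀ i, IsProjectiveCover C (standard R e i) (T i)

/-- `C` is a `Δ`-subalgebra of `(R, ≤)`. -/
def IsDeltaSubalgebra (C : Subalgebra k R) : Prop :=
  ∃ (T : Fin n → Type u) (_ : ∀ i, AddCommGroup (T i)) (_ : ∀ i, Module k (T i))
    (_ : ∀ i, Module C (T i)) (_ : ∀ i, IsScalarTower k C (T i)), IsDeltaSubalgebraVia e C T

end Borel

/-! ### The subalgebra generated by the right-minimal direction-preserving paths

Here `S` is the set of paths in `R`. -/

section Minimal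

variable (k : Type v) [Field k] {R : Type u} [Ring R] [Algebra k R] {n : ℕ} (e : Fin n → R)
  (S : Set R)

/-- The span `L` of the trivial paths. -/
def vertexSpan : Submodule k R := Submodule.span k (Set.range e)

/-- An element is direction-preserving if it lies in `e_j R e_i` for some `i < j`. -/
def IsDirectionPreserving (x : R) : Prop := ∃ i j, i < j ∧ e j * x * e i = x

/-- The subalgebra generated by `L` and all direction-preserving paths. -/
def maxSubalgebra : Subalgebra k R :=
  Algebra.adjoin k ((vertexSpan k e : Set R) ∪ {x ∈ S | IsDirectionPreserving e x})

/-- The product `rad(R) rad(B)` for a subalgebra `B` of `R`. -/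
def radMulRad (B : Subalgebra k R) : Submodule k R :=
  Submodule.span k {x | ∃ a ∈ Ring.jacobson R, ∃ b ∈ Ring.jacobson B, x = a * (b : R)}

/-- `x` is right-minimal direction-preserving: `x` lies in the subalgebra `B_max` generated by `L`
and all direction-preserving paths, but not in `rad(R) rad(B_max)`. -/
def IsRightMinimal (x : R) : Prop :=
  x ∈ maxSubalgebra k e S ∧ x ∉ radMulRad k (maxSubalgebra k e S)

/-- The subalgebra `B_min` generated by all right-minimal direction-preserving paths. -/
def minSubalgebra : Subalgebra k R :=
  Algebra.adjoin k {x ∈ S | IsRightMinimal k e S x}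

end Minimal

/-! ### Reedy decompositions -/

section Reedy

variable {k : Type v} [Field k] {R : Type u} [Ring R] [Algebra k R]
  (L : Submodule k R) (C B : Subalgebra k R)

/-- The relations `(c l) ⊗ b = c ⊗ (l b)`, for `l ∈ L`, in `C ⊗_k B`. -/
def relTensorRel : Submodule k (C ⊗[k] B) :=
  Submodule.span k {x | ∃ l ∈ L, ∃ (c c' : C) (b b' : B),
    (c' : R) = c * l ∧ (b' : R) = l * b ∧ x = c' ⊗ₜ[k] b - c ⊗ₜ[k] b'}

/-- The tensor product `C ⊗_L B`, for subalgebras `C` and `B` that contain the subalgebra `L`. -/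
abbrev RelTensor : Type u := (C ⊗[k] B) ⧸ relTensorRel L C B

/-- The multiplication map `C ⊗_L B → R`, `c ⊗ b ↦ c b`. -/
def relTensorMul : RelTensor L C B →ₗ[k] R :=
  (relTensorRel L C B).liftQ
    (TensorProduct.lift ((LinearMap.mul k R).compl₁₂ C.val.toLinearMap B.val.toLinearMap)) <| by
      refine Submodule.span_le.2 ?_
      rintro _ ⟨l, _, c, c', b, b', hc, hb, rfl⟩
      simp [hc, hb, mul_assoc]

/-- `R = C ⊗_L B`: both `C` and `B` contain `L`, and multiplication is an isomorphism
`C ⊗_L B → R`. -/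
structure IsReedyDecomposition : Prop where
  le_left : L ≤ Subalgebra.toSubmodule C
  le_right : L ≤ Subalgebra.toSubmodule B
  bijective : Function.Bijective (relTensorMul L C B)

end Reedy

/-! ### The subalgebras of a monomial algebra -/

section Monomial

variable (k : Type u) [Field k] {V : Type v} [Quiver.{w} V] [Fintype V] (X : Set (QPath V))
  {n : ℕ} (ν : Fin n ≃ V)

/-- The subalgebra `B_min` of the monomial algebra `A`. -/
def Bmin : Subalgebra k (MonomialAlgebra k X) :=
  minSubalgebra k (vertexIdem k X ν) (pathsIn k X)

/-- The subalgebra `C_min` of the opposite algebra of `A`, generated by its right-minimal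
direction-preserving paths. The paths and the vertex idempotents of the opposite algebra are those
of `A`. -/
def Cmin : Subalgebra k (MonomialAlgebra k X)ᵐᵒᵖ :=
  minSubalgebra k (fun i => MulOpposite.op (vertexIdem k X ν i)) (MulOpposite.op '' pathsIn k X)

end Monomial

end QHMonomial

end

/-! The nonzero paths form a basis of `A` in which a product of two basis elements is zero or a
basis element. Hence the projectives, standard modules, radicals and subalgebras involved are spans
of sets of paths, or quotients of such spans. `PathBasis` records this, and what remains is
combinatorics of the vertices along a path. A path is `SourceMax` or `TargetMax` when no vertex on
it exceeds its source, respectively its target. The standard module Δ_i has the `SourceMax` paths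
starting at `i` as a basis (`mem_standardKernel_iff`).

Since End(Δ_i) is the ground field, no nontrivial closed path is `SourceMax`: right multiplication
by it would be a nonzero nilpotent endomorphism (`len_eq_zero_of_end`). This is `NoReturn`. It
follows that a path visits its largest vertex only once, and so factors uniquely as `c b` with `c`
`SourceMax` and `b` `TargetMax`, cut at that vertex (`factorization_unique`).

The Δ-filtration of `A` shows that conversely every composable pair `(c, b)` of this kind has a
nonzero product (`mul_ne_zero_of_filtered`). If Δ_j occurs m_j times, then dim A = Σ m_j dim Δ_j,
while m_j is at least the number of `TargetMax` paths ending at `j`. So there are at most as many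
pairs as paths, and the injection sending a path to its factorization is onto. This is
`ProductsNonzero`.

Under `NoReturn`, B_min is the span of the `TargetMax` paths (`mem_minSubalgebra_iff`), and dually
C_min is spanned by the `SourceMax` paths. Unique factorization with nonvanishing products makes
multiplication `C ⊗_L B → A` match bases, which is the Reedy decomposition. It also gives `A` a dual
basis as a right B_min-module, so that induction is exact, and Δ_i restricted to `C` is `C e_i`.
Both combinatorial conditions are self-dual, so the claim about the opposite algebra is the same
theorem applied to `P.op`; quasi-heredity of the opposite algebra never enters. -/

noncomputable section

namespace QHMonomial

/-! ### One-dimensional modules given by characters -/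

section CharModule

variable {k : Type*} [Field k] {B : Type*} [Ring B] [Algebra k B]

/-- `M` is the one-dimensional module on which `B` acts through the character `χ`. -/
def IsCharModule (χ : B →ₐ[k] k) (M : Type*) [AddCommGroup M] [Module B M] : Prop :=
  ∃ m : M, m ≠ 0 ∧ (∀ x : M, ∃ b : B, x = b • m) ∧ ∀ b : B, χ b = 0 → b • m = 0

namespace IsCharModule

variable {χ ψ : B →ₐ[k] k} {M N : Type*} [AddCommGroup M] [Module B M] [AddCommGroup N]
  [Module B N]

theorem smul_generator {m : M} (h : ∀ b : B, χ b = 0 → b • m = 0) (b : B) :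
    b • m = algebraMap k B (χ b) • m := by
  rw [← sub_eq_zero, ← sub_smul]
  exact h _ (by simp)

theorem smul_eq (h : IsCharModule χ M) (b : B) (x : M) : b • x = algebraMap k B (χ b) • x := by
  obtain ⟨m, -, hm, h0⟩ := h
  obtain ⟨c, rfl⟩ := hm x
  rw [smul_smul, smul_generator h0 (b * c), smul_generator h0 c, smul_smul, map_mul, map_mul]

theorem exists_smul (h : IsCharModule χ M) {x y : M} (hx : x ≠ 0) :
    ∃ c : k, y = algebraMap k B c • x := by
  obtain ⟨m, -, hm, h0⟩ := h
  obtain ⟨a, rfl⟩ := hm x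
  obtain ⟨b, rfl⟩ := hm y
  rw [smul_generator h0 a] at hx ⊢
  rw [smul_generator h0 b]
  have ha : χ a ≠ 0 := fun h => hx (by simp [h])
  refine ⟨χ b * (χ a)⁻¹, ?_⟩
  rw [smul_smul, ← map_mul, mul_assoc, inv_mul_cancel₀ ha, mul_one]

theorem smul_eq_zero_iff (h : IsCharModule χ M) {x : M} (hx : x ≠ 0) {b : B} :
    b • x = 0 ↔ χ b = 0 := by
  rw [h.smul_eq]
  refine ⟨fun h0 => ?_, fun h0 => by simp [h0]⟩
  by_contra hb
  apply hx
  rw [← one_smul B x, ← map_one (algebraMap k B), ← inv_mul_cancel₀ hb, map_mul, mul_smul, h0,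
    smul_zero]

theorem isSimpleModule (h : IsCharModule χ M) : IsSimpleModule B M := by
  obtain ⟨m, hm0, -⟩ := id h
  rw [isSimpleModule_iff]
  refine { exists_pair_ne := ⟨⊥, ⊤, fun hb => hm0 ?_⟩, eq_bot_or_eq_top := fun U => ?_ }
  · exact (Submodule.mem_bot B).1 (hb ▸ Submodule.mem_top)
  · by_cases hU : U = ⊥
    · exact Or.inl hU
    · obtain ⟨x, hxU, hx⟩ := Submodule.exists_mem_ne_zero_of_ne_bot hU
      refine Or.inr (eq_top_iff.2 fun y _ => ?_)
      obtain ⟨c, rfl⟩ := h.exists_smul (y := y) hx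
      exact U.smul_mem _ hxU

/-- Any nonzero vector generates, with annihilator ker χ, so both modules are `B / ker χ`. -/
theorem nonempty_equiv (hM : IsCharModule χ M) (hN : IsCharModule χ N) :
    Nonempty (M ≃ₗ[B] N) := by
  obtain ⟨m, hm0, -⟩ := id hM
  obtain ⟨x, hx0, -⟩ := id hN
  let f := LinearMap.toSpanSingleton B M m
  let g := LinearMap.toSpanSingleton B N x
  have hf : Function.Surjective f := fun y => by
    obtain ⟨c, rfl⟩ := hM.exists_smul (y := y) hm0
    exact ⟨_, LinearMap.toSpanSingleton_apply ..⟩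
  have hg : Function.Surjective g := fun y => by
    obtain ⟨c, rfl⟩ := hN.exists_smul (y := y) hx0
    exact ⟨_, LinearMap.toSpanSingleton_apply ..⟩
  have hfg : LinearMap.ker f = LinearMap.ker g := by
    ext b
    simp only [LinearMap.mem_ker, f, g, LinearMap.toSpanSingleton_apply]
    rw [hM.smul_eq_zero_iff hm0, hN.smul_eq_zero_iff hx0]
  exact ⟨(f.quotKerEquivOfSurjective hf).symm.trans
    ((Submodule.quotEquivOfEq _ _ hfg).trans (g.quotKerEquivOfSurjective hg))⟩

theorem of_equiv (hM : IsCharModule χ M) (f : M ≃ₗ[B] N) : IsCharModule χ N := by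
  obtain ⟨m, hm0, hm, h0⟩ := hM
  refine ⟨f m, by simpa using hm0, fun x => ?_, fun b hb => by rw [← map_smul, h0 b hb, map_zero]⟩
  obtain ⟨b, hb⟩ := hm (f.symm x)
  exact ⟨b, by rw [← map_smul, ← hb, f.apply_symm_apply]⟩

theorem character_unique (hM : IsCharModule χ M) (hM' : IsCharModule ψ M) (b : B) : χ b = ψ b := by
  obtain ⟨m, hm0, -⟩ := id hM
  have h : (b - algebraMap k B (ψ b)) • m = 0 := by
    rw [sub_smul, ← hM'.smul_eq, sub_self]
  rw [hM.smul_eq_zero_iff hm0] at h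
  simpa [sub_eq_zero] using h

theorem nonempty_end_equiv [Module k M] [IsScalarTower k B M] (hM : IsCharModule χ M) :
    Nonempty (Module.End B M ≃ₐ[k] k) := by
  obtain ⟨m, hm0, -⟩ := id hM
  have : Nontrivial M := ⟨m, 0, hm0⟩
  refine ⟨(AlgEquiv.ofBijective (Algebra.ofId k (Module.End B M))
    ⟨(algebraMap k (Module.End B M)).injective, fun f => ?_⟩).symm⟩
  obtain ⟨c, hc⟩ := hM.exists_smul (y := f m) hm0
  refine ⟨c, LinearMap.ext fun x => ?_⟩
  obtain ⟨d, rfl⟩ := hM.exists_smul (y := x) hm0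
  rw [map_smul, map_smul, hc]
  change algebraMap k B d • (c • m) = _
  rw [algebraMap_smul, algebraMap_smul, algebraMap_smul]

theorem subalgebra (hM : IsCharModule χ M) (C : Subalgebra k B) :
    IsCharModule (χ.comp C.val) M := by
  obtain ⟨m, hm0, -, h0⟩ := id hM
  refine ⟨m, hm0, fun x => ?_, fun b hb => h0 _ hb⟩
  obtain ⟨c, rfl⟩ := hM.exists_smul (y := x) hm0
  exact ⟨algebraMap k C c, rfl⟩

end IsCharModule

end CharModule

/-! ### Basic split algebras -/

section Basic

variable {k : Type*} [Field k] {B : Type u} [Ring B] [Algebra k B] {n : ℕ}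

/-- `B` is split basic: the characters `χ i`, dual to the idempotents `e i`, have a nil common
kernel. -/
structure IsSplitBasic (χ : Fin n → B →ₐ[k] k) (e : Fin n → B) : Prop where
  nil : ∀ x, (∀ i, χ i x = 0) → IsNilpotent x
  idem : ∀ i, e i * e i = e i
  apply : ∀ i j, χ i (e j) = if i = j then 1 else 0

namespace IsSplitBasic

variable {χ : Fin n → B →ₐ[k] k} {e : Fin n → B}

/-- The common kernel of the characters is a nil ideal, hence contained in the radical; a character
to a field kills the radical. -/
theorem mem_jacobson (h : IsSplitBasic χ e) {x : B} :
    x ∈ Ring.jacobson B ↔ ∀ i, χ i x = 0 := by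
  rw [← Ideal.jacobson_bot, Ideal.mem_jacobson_iff]
  constructor
  · intro hx i
    by_contra hc
    -- The scalar is chosen so that `χ i` kills `1 + y x`, which therefore has no left inverse.
    obtain ⟨z, hz⟩ := hx (algebraMap k B (-(χ i x)⁻¹))
    rw [Ideal.mem_bot] at hz
    have := congrArg (χ i) hz
    simp [mul_assoc, inv_mul_cancel₀ hc] at this
  · intro hx y
    have : IsNilpotent (y * x) := h.nil _ fun i => by simp [hx i]
    obtain ⟨⟨u, v, huv, hvu⟩, hu⟩ := this.isUnit_one_add
    refine ⟨v, ?_⟩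
    dsimp only at hu
    rw [hu, mul_add, mul_one] at hvu
    rw [Ideal.mem_bot, mul_assoc, sub_eq_zero, add_comm]
    exact hvu

theorem isUnit_one_sub (h : IsSplitBasic χ e) {x : B} (hx : ∀ i, χ i x = 0) : IsUnit (1 - x) :=
  (h.nil x hx).isUnit_one_sub

theorem jacobson_smul {M : Type*} [AddCommGroup M] [Module B M] [IsSimpleModule B M] {x : B}
    (hx : x ∈ Ring.jacobson B) (m : M) : x • m = 0 := by
  have h1 : x • m ∈ Module.jacobson B M :=
    Ring.jacobson_smul_top_le B M (Submodule.smul_mem_smul hx Submodule.mem_top)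
  have h2 : Module.jacobson B M = ⊥ := by
    refine le_bot_iff.1 (sInf_le ?_)
    exact isCoatom_bot
  rwa [h2, Submodule.mem_bot] at h1

/-- The radical annihilates a simple module. It contains `1 - ∑ e i`, so some `e i • m` is nonzero,
and it contains `b * e i` whenever `χ i b = 0`, so `B` acts on `e i • m` through `χ i`. -/
theorem exists_isCharModule (h : IsSplitBasic χ e) (M : Type*) [AddCommGroup M] [Module B M]
    [IsSimpleModule B M] : ∃ i, IsCharModule (χ i) M := by
  have := IsSimpleModule.nontrivial B M
  obtain ⟨m, hm⟩ := exists_ne (0 : M)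
  have h1 : ∃ i, e i • m ≠ 0 := by
    by_contra! h0
    have hJ : (1 - ∑ i, e i) ∈ Ring.jacobson B := by
      rw [h.mem_jacobson]
      intro i
      simp [h.apply]
    have := jacobson_smul hJ m
    rw [sub_smul, Finset.sum_smul, Finset.sum_eq_zero (fun i _ => h0 i), one_smul, sub_zero] at this
    exact hm this
  obtain ⟨i, hi⟩ := h1
  refine ⟨i, e i • m, hi, fun x => ?_, fun b hb => ?_⟩
  · have : Submodule.span B {e i • m} = ⊤ := by
      refine (eq_bot_or_eq_top _).resolve_left fun h0 => hi ?_
      rwa [Submodule.span_singleton_eq_bot] at h0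
    have hx : x ∈ Submodule.span B {e i • m} := this ▸ Submodule.mem_top
    obtain ⟨b, rfl⟩ := Submodule.mem_span_singleton.1 hx
    exact ⟨b, rfl⟩
  · rw [smul_smul]
    refine jacobson_smul ?_ m
    rw [h.mem_jacobson]
    intro j
    rw [map_mul, h.apply]
    split_ifs with hj
    · rw [hj, hb, zero_mul]
    · rw [mul_zero]

theorem isSimpleList (h : IsSplitBasic χ e) {S : Fin n → Type u} [∀ i, AddCommGroup (S i)]
    [∀ i, Module B (S i)] (hS : ∀ i, IsCharModule (χ i) (S i)) : IsSimpleList B S where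
  isSimple i := (hS i).isSimpleModule
  injective i j := by
    rintro ⟨f⟩
    have := ((hS i).of_equiv f).character_unique (hS j) (e i)
    rw [h.apply, h.apply, if_pos rfl] at this
    by_contra hij
    rw [if_neg (Ne.symm hij)] at this
    exact one_ne_zero this
  surjective M _ _ _ := by
    obtain ⟨i, hi⟩ := h.exists_isCharModule M
    exact ⟨i, hi.nonempty_equiv (hS i)⟩

theorem mem_proj (h : IsSplitBasic χ e) {i : Fin n} {x : B} : x ∈ proj B e i ↔ x * e i = x := by
  rw [Submodule.mem_span_singleton]
  constructor
  · rintro ⟨a, rfl⟩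
    rw [smul_eq_mul, mul_assoc, h.idem]
  · exact fun hx => ⟨x, hx⟩

theorem mem_jacobson_proj (h : IsSplitBasic χ e) {i : Fin n} {x : proj B e i} :
    x ∈ Module.jacobson B (proj B e i) ↔ χ i x = 0 := by
  constructor
  · intro hx
    have h1 := Module.le_comap_jacobson (proj B e i).subtype hx
    exact h.mem_jacobson.1 h1 i
  · intro hx
    have hxi := h.mem_proj.1 x.2
    have h1 : (x : B) ∈ Ring.jacobson B := by
      rw [h.mem_jacobson]
      intro j
      rw [← hxi, map_mul, h.apply]
      split_ifs with hj
      · rw [hj, hx, zero_mul]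
      · rw [mul_zero]
    have h2 : x = (x : B) • (⟨e i, Submodule.mem_span_singleton_self _⟩ : proj B e i) :=
      Subtype.ext hxi.symm
    rw [h2]
    exact Ring.jacobson_smul_top_le B _ (Submodule.smul_mem_smul h1 Submodule.mem_top)

theorem isCharModule_simple (h : IsSplitBasic χ e) (i : Fin n) :
    IsCharModule (χ i) (simple B e i) := by
  refine ⟨Submodule.Quotient.mk ⟨e i, Submodule.mem_span_singleton_self _⟩, ?_, ?_, ?_⟩
  · rw [Ne, Submodule.Quotient.mk_eq_zero, h.mem_jacobson_proj, h.apply, if_pos rfl]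
    exact one_ne_zero
  · intro x
    obtain ⟨⟨x, hx⟩, rfl⟩ := Submodule.Quotient.mk_surjective _ x
    refine ⟨x, ?_⟩
    rw [← Submodule.Quotient.mk_smul]
    congr 1
    exact Subtype.ext (h.mem_proj.1 hx).symm
  · intro b hb
    rw [← Submodule.Quotient.mk_smul, Submodule.Quotient.mk_eq_zero, h.mem_jacobson_proj]
    simp [hb]

/-- Replaces multiplicities by the action of idempotents. If `g = e j • m` is nonzero, then `B g /
rad(B) g` is nonzero by Nakayama and has character `χ j`. Conversely `e j` acts as the identity on
L_j, so it cannot annihilate a module with that subquotient. -/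
theorem isCompositionFactor_iff (h : IsSplitBasic χ e) {j : Fin n} {M : Type*} [AddCommGroup M]
    [Module B M] : IsCompositionFactor B (simple B e j) M ↔ ∃ m : M, e j • m ≠ 0 := by
  constructor
  · rintro ⟨N, N', hN, ⟨f⟩⟩
    by_contra! h0
    have hc := (h.isCharModule_simple j).of_equiv f.symm
    obtain ⟨x, hx, -⟩ := id hc
    have h1 := mt (hc.smul_eq_zero_iff hx (b := e j)).1 (by simp [h.apply])
    obtain ⟨y, rfl⟩ := Submodule.Quotient.mk_surjective _ x
    apply h1
    rw [← Submodule.Quotient.mk_smul, show e j • y = 0 from Subtype.ext (h0 y)]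
    rfl
  · rintro ⟨m, hm⟩
    let g : M := e j • m
    let N : Submodule B M := Submodule.map (LinearMap.toSpanSingleton B M g) (Ring.jacobson B)
    let N' : Submodule B M := Submodule.span B {g}
    have hNN : N ≤ N' := by
      rintro _ ⟨b, -, rfl⟩
      exact Submodule.mem_span_singleton.2 ⟨b, rfl⟩
    have hgN : g ∉ N := by
      rintro ⟨b, hb, hbg⟩
      have hu := h.isUnit_one_sub (h.mem_jacobson.1 hb)
      refine hm ?_
      have : (1 - b) • g = 0 := by
        rw [sub_smul, one_smul, sub_eq_zero]
        exact hbg.symm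
      exact (hu.smul_eq_zero).1 this
    refine ⟨N, N', hNN, ?_⟩
    refine IsCharModule.nonempty_equiv (χ := χ j) ?_ (h.isCharModule_simple j)
    refine ⟨Submodule.Quotient.mk ⟨g, Submodule.mem_span_singleton_self _⟩, ?_, ?_, ?_⟩
    · rw [Ne, Submodule.Quotient.mk_eq_zero]
      exact hgN
    · intro x
      obtain ⟨⟨x, hx⟩, rfl⟩ := Submodule.Quotient.mk_surjective _ x
      obtain ⟨b, rfl⟩ := Submodule.mem_span_singleton.1 hx
      exact ⟨b, rfl⟩
    · intro b hb
      rw [← Submodule.Quotient.mk_smul, Submodule.Quotient.mk_eq_zero]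
      refine ⟨b * e j, ?_, ?_⟩
      · rw [SetLike.mem_coe, h.mem_jacobson]
        intro l
        rw [map_mul, h.apply]
        split_ifs with hl
        · rw [hl, hb, zero_mul]
        · rw [mul_zero]
      · change (b * e j) • e j • m = b • e j • m
        rw [smul_smul, smul_smul, mul_assoc, h.idem]

/-- By `isCompositionFactor_iff`, L_j is not a factor of P_i / U exactly when `U` contains e_j P_i,
so the smallest such `U` is generated by these spaces. -/
theorem standardKernel_eq (h : IsSplitBasic χ e) (i : Fin n) :
    standardKernel B e i =
      Submodule.span B {y : proj B e i | ∃ j, i < j ∧ e j • y = y} := by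
  apply le_antisymm
  · refine sInf_le fun j hj => ?_
    rw [h.isCompositionFactor_iff]
    rintro ⟨m, hm⟩
    obtain ⟨y, rfl⟩ := Submodule.Quotient.mk_surjective _ m
    refine hm ?_
    rw [← Submodule.Quotient.mk_smul, Submodule.Quotient.mk_eq_zero]
    exact Submodule.subset_span ⟨j, hj, by rw [smul_smul, h.idem]⟩
  · refine le_sInf fun U hU => Submodule.span_le.2 ?_
    rintro y ⟨j, hj, hy⟩
    have := hU j hj
    rw [h.isCompositionFactor_iff] at this
    push Not at this
    have h1 := this (Submodule.Quotient.mk y)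
    rwa [← Submodule.Quotient.mk_smul, Submodule.Quotient.mk_eq_zero, hy] at h1

end IsSplitBasic

end Basic

/-! ### Vanishing of extensions between one-dimensional modules -/

section Ext

open CategoryTheory

theorem projective_span_idem {B : Type*} [Ring B] {e : B} (he : e * e = e) :
    Module.Projective B (Submodule.span B {e}) := by
  refine Module.Projective.of_split (Submodule.span B {e}).subtype
    (LinearMap.toSpanSingleton B _ ⟨e, Submodule.mem_span_singleton_self _⟩)
    (LinearMap.ext fun x => Subtype.ext ?_)
  obtain ⟨a, ha⟩ := Submodule.mem_span_singleton.1 x.2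
  change (x : B) * e = x
  rw [← ha, smul_eq_mul, mul_assoc, he]

/-- With `K` the kernel of the projective presentation `B e → S`, the group Ext¹(S, T) is a quotient
of Hom(K, T). The latter vanishes: `f` acts as the identity on `T` but kills `B e`, hence `K`. -/
theorem subsingleton_ext_of_idem {k : Type*} [Field k] {B : Type u} [Ring B] [Algebra k B]
    {χ ψ : B →ₐ[k] k} {S T : Type u} [AddCommGroup S] [Module B S] [AddCommGroup T] [Module B T]
    (hS : IsCharModule χ S) (hT : IsCharModule ψ T) {e f : B} (he : e * e = e) (hχ : χ e = 1)
    (hψ : ψ f = 1) (hef : ∀ b, f * b * e = 0) :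
    Subsingleton (Abelian.Ext (ModuleCat.of B S) (ModuleCat.of B T) 1) := by
  obtain ⟨s, hs0, -⟩ := id hS
  let P : Submodule B B := Submodule.span B {e}
  have hP : ∀ x : P, (x : B) * e = x := fun x => by
    obtain ⟨a, ha⟩ := Submodule.mem_span_singleton.1 x.2
    rw [← ha, smul_eq_mul, mul_assoc, he]
  let q : P →ₗ[B] S := (LinearMap.toSpanSingleton B S s).comp P.subtype
  let K : Submodule B P := LinearMap.ker q
  have hPproj : Module.Projective B P := projective_span_idem he
  have hes : e • s = s := by rw [hS.smul_eq, hχ, map_one, one_smul]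
  have hq : Function.Surjective q := fun y => by
    obtain ⟨c, rfl⟩ := hS.exists_smul (y := y) hs0
    refine ⟨algebraMap k B c • ⟨e, Submodule.mem_span_singleton_self _⟩, ?_⟩
    change (algebraMap k B c * e) • s = _
    rw [mul_smul, hes]
  let Sq : ShortComplex (ModuleCat.{u} B) :=
    ShortComplex.mk (ModuleCat.ofHom K.subtype) (ModuleCat.ofHom q) (by
      ext x
      exact x.2)
  have hSq : Sq.ShortExact :=
    { exact := by
        rw [ShortComplex.moduleCat_exact_iff]
        intro x hx
        exact ⟨⟨x, hx⟩, rfl⟩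
      mono_f := (ModuleCat.mono_iff_injective _).2 K.subtype_injective
      epi_g := (ModuleCat.epi_iff_surjective _).2 hq }
  have : Projective Sq.X₂ := (IsProjective.iff_projective P).1 hPproj
  refine subsingleton_of_forall_eq 0 fun x => ?_
  obtain ⟨y, rfl⟩ := Abelian.Ext.contravariant_sequence_exact₃ hSq (ModuleCat.of B T) x
    (Abelian.Ext.eq_zero_of_projective _) (n₀ := 0) rfl
  obtain ⟨g, rfl⟩ := (Abelian.Ext.mk₀_bijective _ _).2 y
  have hg : g = 0 := by
    ext z
    change g.hom z = 0
    have h1 : f • z = 0 := by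
      refine Subtype.ext (Subtype.ext ?_)
      change f * ((z : P) : B) = 0
      rw [← hP, ← mul_assoc]
      exact hef _
    rw [← one_smul B (g.hom z), ← map_one (algebraMap k B), ← hψ, ← hT.smul_eq, ← map_smul, h1,
      map_zero]
  rw [hg]
  simp

end Ext

/-! ### Vertices of a path -/

section Vertices

variable {V : Type v} [Quiver.{w} V]

/-- The vertex that a path reaches after `t` steps. -/
def vertexAt {a : V} : ∀ {b : V}, Quiver.Path a b → ℕ → V
  | _, Quiver.Path.nil, _ => a
  | b, Quiver.Path.cons p _, t => if t ≤ p.length then vertexAt p t else b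

theorem vertexAt_zero {a b : V} (p : Quiver.Path a b) : vertexAt p 0 = a := by
  induction p with
  | nil => rfl
  | cons p e ih => simpa [vertexAt] using ih

theorem vertexAt_length {a b : V} (p : Quiver.Path a b) : vertexAt p p.length = b := by
  cases p with
  | nil => rfl
  | cons p e => simp [vertexAt]

theorem vertexAt_comp_left {a b c : V} (p : Quiver.Path a b) (q : Quiver.Path b c) {t : ℕ}
    (ht : t ≤ p.length) : vertexAt (p.comp q) t = vertexAt p t := by
  induction q with
  | nil => rfl
  | cons q e ih =>
    rw [Quiver.Path.comp_cons, vertexAt, if_pos (by rw [Quiver.Path.length_comp]; omega), ih]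

theorem vertexAt_comp_right {a b c : V} (p : Quiver.Path a b) (q : Quiver.Path b c) {t : ℕ}
    (ht : t ≤ q.length) : vertexAt (p.comp q) (p.length + t) = vertexAt q t := by
  induction q with
  | nil =>
    obtain rfl : t = 0 := by simpa using ht
    exact vertexAt_length p
  | cons q e ih =>
    rw [Quiver.Path.comp_cons, vertexAt, vertexAt, Quiver.Path.length_comp]
    by_cases h : t ≤ q.length
    · rw [if_pos (by omega), if_pos h, ih h]
    · rw [if_neg (by omega), if_neg h]

namespace QPath

/-- The vertex that a path reaches after `t` steps. -/
def vert (p : QPath V) (t : ℕ) : V := vertexAt p.path t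

theorem length_comp (p q : QPath V) (h : q.tgt = p.src) :
    (p.comp q h).length = q.length + p.length := by
  obtain ⟨a, b, p⟩ := p
  obtain ⟨c, d, q⟩ := q
  dsimp only at h
  subst h
  simp [comp, length]

theorem vert_comp_left (p q : QPath V) (h : q.tgt = p.src) {t : ℕ} (ht : t ≤ q.length) :
    (p.comp q h).vert t = q.vert t :=
  vertexAt_comp_left _ _ ht

theorem vert_comp_right (p q : QPath V) (h : q.tgt = p.src) {t : ℕ} (ht : t ≤ p.length) :
    (p.comp q h).vert (q.length + t) = p.vert t := by
  obtain ⟨a, b, p⟩ := p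
  obtain ⟨c, d, q⟩ := q
  dsimp only at h
  subst h
  exact vertexAt_comp_right _ _ ht

theorem eq_trivial {p : QPath V} (h : p.length = 0) : p = trivial p.src := by
  obtain ⟨a, b, p⟩ := p
  obtain rfl := Quiver.Path.eq_of_length_zero p h
  obtain rfl := Quiver.Path.eq_nil_of_length_zero p h
  rfl

theorem exists_eq_comp (p : QPath V) {t : ℕ} (ht : t ≤ p.length) :
    ∃ (q r : QPath V) (h : r.tgt = q.src), p = q.comp r h ∧ r.length = t := by
  obtain ⟨a, b, p⟩ := p
  obtain ⟨v, p₁, p₂, rfl, hl⟩ := p.exists_eq_comp_of_le_length ht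
  exact ⟨⟨v, b, p₂⟩, ⟨a, v, p₁⟩, rfl, rfl, hl⟩

/-- The middle vertex can be read off the composite after `q.length` steps; once the two middle
vertices are identified, cancellation for `Quiver.Path` applies. -/
theorem comp_cancel {p q p' q' : QPath V} {h : q.tgt = p.src} {h' : q'.tgt = p'.src}
    (he : p.comp q h = p'.comp q' h') (hl : q.length = q'.length) : p = p' ∧ q = q' := by
  have hv : q.tgt = q'.tgt := by
    rw [← vertexAt_length q.path, ← vertexAt_length q'.path]
    change q.vert q.length = q'.vert q'.length
    rw [← vert_comp_left p q h le_rfl, ← vert_comp_left p' q' h' le_rfl, he, hl]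
  obtain ⟨a, b, p⟩ := p
  obtain ⟨c, d, q⟩ := q
  obtain ⟨a', b', p'⟩ := p'
  obtain ⟨c', d', q'⟩ := q'
  dsimp only at h h' hv
  subst h h' hv
  obtain rfl : c = c' := congrArg QPath.src he
  obtain rfl : b = b' := congrArg QPath.tgt he
  have h1 : q.comp p = q'.comp p' := by
    simpa [comp] using he
  obtain ⟨rfl, rfl⟩ := (Quiver.Path.comp_inj' hl).1 h1
  exact ⟨rfl, rfl⟩

theorem finite_length_eq [Finite V] [∀ a b : V, Finite (a ⟶ b)] (m : ℕ) :
    {p : QPath V | p.length = m}.Finite := by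
  classical
  induction m with
  | zero =>
    refine (Set.finite_range (trivial (V := V))).subset fun p hp => ?_
    exact ⟨p.src, (eq_trivial hp).symm⟩
  | succ m ih =>
    have : Finite (Σ' (a b : V), (a ⟶ b)) := inferInstance
    -- The value for an arrow that does not start at the end of `p` is irrelevant: `f` only has to
    -- reach every path of length `m + 1`.
    let f : QPath V → (Σ' (a b : V), (a ⟶ b)) → QPath V := fun p x =>
      if h : p.tgt = x.1 then ⟨p.src, x.2.1, (p.path.cast rfl h).cons x.2.2⟩ else p
    refine (ih.image2 f (Set.finite_univ)).subset ?_
    rintro ⟨a, b, p⟩ hp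
    cases p with
    | nil => simp [length] at hp
    | @cons c _ p e =>
      refine ⟨⟨a, c, p⟩, by simpa [length] using hp, ⟨c, b, e⟩, Set.mem_univ _, ?_⟩
      simp [f]

theorem finite_length_lt [Finite V] [∀ a b : V, Finite (a ⟶ b)] (m : ℕ) :
    {p : QPath V | p.length < m}.Finite := by
  refine ((Set.finite_lt_nat m).biUnion fun i _ => finite_length_eq i).subset fun p hp => ?_
  simp only [Set.mem_iUnion]
  exact ⟨p.length, hp, rfl⟩

end QPath

end Vertices

/-! ### Algebras with a basis of paths -/

open Module

/-- A basis of the algebra `R` whose elements behave like the nonzero paths of a monomial algebra: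
they have lengths and vertices, the product of two of them is zero or again in the basis, and
each of them has unique factorizations at all of its vertices. -/
structure PathBasis (k : Type*) [Field k] {R : Type*} [Ring R] [Algebra k R] {n : ℕ}
    (e : Fin n → R) (ι : Type*) where
  basis : Basis ι k R
  len : ι → ℕ
  vert : ι → ℕ → Fin n
  triv : Fin n → ι
  basis_triv : ∀ i, basis (triv i) = e i
  len_triv : ∀ i, len (triv i) = 0
  vert_triv : ∀ i, vert (triv i) 0 = i
  eq_triv : ∀ p, len p = 0 → p = triv (vert p 0)
  mul : ∀ p q, basis p * basis q = 0 ∨ ∃ r, basis p * basis q = basis r ∧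
    len r = len q + len p ∧ (∀ t ≤ len q, vert r t = vert q t) ∧
    ∀ t ≤ len p, vert r (len q + t) = vert p t
  split : ∀ p t, t ≤ len p → ∃ q r, basis q * basis r = basis p ∧ len r = t
  cancel : ∀ p q p' q', basis p * basis q = basis p' * basis q' → basis p * basis q ≠ 0 →
    len q = len q' → p = p' ∧ q = q'

/-- The paths of the opposite algebra. -/
def PathBasis.op {k : Type*} [Field k] {R : Type*} [Ring R] [Algebra k R] {n : ℕ}
    {e : Fin n → R} {ι : Type*} (P : PathBasis k e ι) :
    PathBasis k (fun i => MulOpposite.op (e i)) ι where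
  basis := P.basis.mulOpposite
  len := P.len
  -- Beyond the length the truncated subtraction returns the source, a value that no axiom
  -- constrains.
  vert p t := P.vert p (P.len p - t)
  triv := P.triv
  basis_triv i := by simp [P.basis_triv]
  len_triv := P.len_triv
  vert_triv i := by simp [P.len_triv, P.vert_triv]
  eq_triv p hp := by rw [hp]; exact P.eq_triv p hp
  mul p q := by
    simp only [Basis.mulOpposite_apply, ← MulOpposite.op_mul]
    rcases P.mul q p with h | ⟨r, h, hl, h1, h2⟩
    · exact Or.inl (by rw [h, MulOpposite.op_zero])
    · refine Or.inr ⟨r, by rw [h], by omega, fun t ht => ?_, fun t ht => ?_⟩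
      · rw [hl, Nat.add_sub_assoc ht, h2 _ (Nat.sub_le _ _)]
      · rw [← h1 _ (Nat.sub_le _ _)]
        congr 1
        omega
  split p t ht := by
    obtain ⟨q, r, h, hl⟩ := P.split p (P.len p - t) (Nat.sub_le _ _)
    refine ⟨r, q, by simp [← MulOpposite.op_mul, h], ?_⟩
    rcases P.mul q r with h0 | ⟨s, hs, hsl, -⟩
    · exact absurd (h.symm.trans h0) (P.basis.ne_zero p)
    · obtain rfl := P.basis.injective (h.symm.trans hs)
      omega
  cancel p q p' q' h h0 hl := by
    simp only [Basis.mulOpposite_apply, ← MulOpposite.op_mul, MulOpposite.op_inj, Ne,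
      MulOpposite.op_eq_zero_iff] at h h0
    rcases P.mul q p with h1 | ⟨r, hr, hrl, -⟩
    · exact absurd h1 h0
    rcases P.mul q' p' with h1 | ⟨s, hs, hsl, -⟩
    · exact absurd (h.trans h1) h0
    obtain rfl := P.basis.injective (hr.symm.trans (h.trans hs))
    exact (P.cancel _ _ _ _ h h0 (by omega)).symm

/-! ### The path basis of a monomial algebra -/

section MonomialBasis

variable (k : Type u) [Field k] {V : Type v} [Quiver.{w} V]

/-- The paths form a basis of the path algebra. -/
def pathAlgebraBasis : Basis (QPath V) k (PathAlgebra k V) :=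
  (Finsupp.basisSingleOne : Basis (QPath V) k (QPath V →₀ k))

theorem coe_pathAlgebraBasis : ⇑(pathAlgebraBasis k (V := V)) = PathAlgebra.ofPath k := by
  ext1 p
  exact congrFun Finsupp.coe_basisSingleOne p

variable [Fintype V] {X : Set (QPath V)}

theorem ofPath_mul_mem {Z : Set (QPath V)}
    (hr : ∀ p q h, p ∈ Z → QPath.comp p q h ∈ Z) {x : PathAlgebra k V}
    (hx : x ∈ Submodule.span k (PathAlgebra.ofPath k '' Z)) (y : PathAlgebra k V) :
    x * y ∈ Submodule.span k (PathAlgebra.ofPath k '' Z) := by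
  have hy : y ∈ Submodule.span k (Set.range (PathAlgebra.ofPath k)) := by
    rw [← coe_pathAlgebraBasis, Basis.span_eq]
    trivial
  refine (Submodule.mul_le.2 fun a ha b hb => ?_ : _ * _ ≤ _) (Submodule.mul_mem_mul hx hy)
  have := Submodule.mul_mem_mul ha hb
  rw [Submodule.span_mul_span] at this
  refine (Submodule.span_le.2 ?_) this
  rintro _ ⟨_, ⟨p, hp, rfl⟩, _, ⟨q, rfl⟩, rfl⟩
  dsimp only
  rw [PathAlgebra.ofPath_mul_ofPath, PathAlgebra.pathMul]
  split_ifs with h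
  · exact Submodule.subset_span ⟨_, hr p q h hp, rfl⟩
  · exact Submodule.zero_mem _

theorem mul_ofPath_mem {Z : Set (QPath V)}
    (hl : ∀ p q h, q ∈ Z → QPath.comp p q h ∈ Z) {x : PathAlgebra k V}
    (hx : x ∈ Submodule.span k (PathAlgebra.ofPath k '' Z)) (y : PathAlgebra k V) :
    y * x ∈ Submodule.span k (PathAlgebra.ofPath k '' Z) := by
  have hy : y ∈ Submodule.span k (Set.range (PathAlgebra.ofPath k)) := by
    rw [← coe_pathAlgebraBasis, Basis.span_eq]
    trivial
  have := Submodule.mul_mem_mul hy hx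
  rw [Submodule.span_mul_span] at this
  refine (Submodule.span_le.2 ?_) this
  rintro _ ⟨_, ⟨p, rfl⟩, _, ⟨q, hq, rfl⟩, rfl⟩
  dsimp only
  rw [PathAlgebra.ofPath_mul_ofPath, PathAlgebra.pathMul]
  split_ifs with h
  · exact Submodule.subset_span ⟨_, hl p q h hq, rfl⟩
  · exact Submodule.zero_mem _

/-- The span of a set of paths closed under composition on both sides is a two-sided ideal. Applied
to the paths of positive length it shows that trivial paths survive in `A`; applied to the paths in
`I` it shows that `I` is spanned by paths. -/
theorem monomialIdeal_subset_span {Z : Set (QPath V)} (hX : X ⊆ Z)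
    (hr : ∀ p q h, p ∈ Z → QPath.comp p q h ∈ Z) (hl : ∀ p q h, q ∈ Z → QPath.comp p q h ∈ Z)
    {x : PathAlgebra k V} (hx : x ∈ monomialIdeal k X) :
    x ∈ Submodule.span k (PathAlgebra.ofPath k '' Z) := by
  let S := Submodule.span k (PathAlgebra.ofPath k '' Z)
  let J : TwoSidedIdeal (PathAlgebra k V) := TwoSidedIdeal.mk' S S.zero_mem
    (fun {x y} hx hy => S.add_mem hx hy) (fun {x} hx => S.neg_mem hx)
    (fun {y x} hx => mul_ofPath_mem k hl hx y) (fun {x y} hx => ofPath_mul_mem k hr hx y)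
  have h1 : monomialIdeal k X ≤ J := by
    refine TwoSidedIdeal.span_le.2 ?_
    rintro _ ⟨p, hp, rfl⟩
    rw [SetLike.mem_coe, TwoSidedIdeal.mem_mk']
    exact Submodule.subset_span ⟨p, hX hp, rfl⟩
  have h2 := h1 hx
  rwa [TwoSidedIdeal.mem_mk'] at h2

theorem comp_mem_left (p q : QPath V) (h : q.tgt = p.src)
    (hp : PathAlgebra.ofPath k p ∈ monomialIdeal k X) :
    PathAlgebra.ofPath k (p.comp q h) ∈ monomialIdeal k X := by
  have := (monomialIdeal k X).mul_mem_right _ (PathAlgebra.ofPath k q) hp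
  rwa [PathAlgebra.ofPath_mul_ofPath, PathAlgebra.pathMul, dif_pos h] at this

theorem comp_mem_right (p q : QPath V) (h : q.tgt = p.src)
    (hq : PathAlgebra.ofPath k q ∈ monomialIdeal k X) :
    PathAlgebra.ofPath k (p.comp q h) ∈ monomialIdeal k X := by
  have := (monomialIdeal k X).mul_mem_left (PathAlgebra.ofPath k p) _ hq
  rwa [PathAlgebra.ofPath_mul_ofPath, PathAlgebra.pathMul, dif_pos h] at this

theorem trivial_notMem (hX : ∀ p ∈ X, 2 ≤ p.length) (a : V) :
    PathAlgebra.ofPath k (QPath.trivial a) ∉ monomialIdeal k X := by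
  intro h
  have h1 := monomialIdeal_subset_span k (Z := {p | 1 ≤ p.length})
    (fun p hp => (hX p hp).trans' one_le_two)
    (fun p q h hp => by
      rw [Set.mem_ofPred_eq, QPath.length_comp]
      exact le_add_left hp)
    (fun p q h hq => by
      rw [Set.mem_ofPred_eq, QPath.length_comp]
      exact le_add_right hq) h
  rw [← coe_pathAlgebraBasis, Basis.self_mem_span_image] at h1
  simp [QPath.trivial, QPath.length] at h1

variable (X)

/-- The nonzero paths of a monomial algebra. -/
abbrev NonzeroPath : Type _ := {p : QPath V // PathAlgebra.ofPath k p ∉ monomialIdeal k X}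

theorem mk_eq_zero_iff (x : PathAlgebra k V) :
    (monomialIdeal k X).ringCon.mkₐ k x = 0 ↔ x ∈ monomialIdeal k X := by
  rw [TwoSidedIdeal.mem_iff, ← RingCon.eq]
  rfl

theorem pathClass_eq_zero {p : QPath V} (h : PathAlgebra.ofPath k p ∈ monomialIdeal k X) :
    pathClass k X p = 0 :=
  (mk_eq_zero_iff k X _).2 h

theorem pathClass_mul_of_eq (p q : QPath V) (h : q.tgt = p.src) :
    pathClass k X p * pathClass k X q = pathClass k X (p.comp q h) := by
  rw [pathClass, pathClass, ← map_mul, PathAlgebra.ofPath_mul_ofPath, PathAlgebra.pathMul,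
    dif_pos h]
  rfl

theorem pathClass_mul_of_ne (p q : QPath V) (h : q.tgt ≠ p.src) :
    pathClass k X p * pathClass k X q = 0 := by
  rw [pathClass, pathClass, ← map_mul, PathAlgebra.ofPath_mul_ofPath, PathAlgebra.pathMul,
    dif_neg h, map_zero]

/-- As `I` is spanned by the paths it contains, it meets the span of the remaining paths only in
zero. -/
theorem linearIndependent_pathClass :
    LinearIndependent k fun p : NonzeroPath k X => pathClass k X p.1 := by
  have h1 : LinearIndependent k fun p : NonzeroPath k X => PathAlgebra.ofPath k p.1 := by
    have := (pathAlgebraBasis k (V := V)).linearIndependent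
    rw [coe_pathAlgebraBasis] at this
    exact this.comp _ Subtype.val_injective
  refine h1.map (f := ((monomialIdeal k X).ringCon.mkₐ k).toLinearMap) ?_
  rw [Submodule.disjoint_def]
  intro x hx hx'
  rw [LinearMap.mem_ker, AlgHom.toLinearMap_apply, mk_eq_zero_iff] at hx'
  have h2 := monomialIdeal_subset_span k
    (Z := {p | PathAlgebra.ofPath k p ∈ monomialIdeal k X})
    (fun p hp => TwoSidedIdeal.subset_span ⟨p, hp, rfl⟩)
    (fun p q h hp => comp_mem_left k p q h hp) (fun p q h hq => comp_mem_right k p q h hq) hx'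
  have h3 : Set.range (fun p : NonzeroPath k X => PathAlgebra.ofPath k p.1) =
      PathAlgebra.ofPath k '' {p | PathAlgebra.ofPath k p ∈ monomialIdeal k X}ᶜ := by
    ext y
    simp
  rw [h3] at hx
  rw [← coe_pathAlgebraBasis] at hx h2
  exact (Submodule.disjoint_def.1
    ((pathAlgebraBasis k).linearIndependent.disjoint_span_image disjoint_compl_right)) x h2 hx

theorem span_pathClass :
    ⊤ ≤ Submodule.span k (Set.range fun p : NonzeroPath k X => pathClass k X p.1) := by
  rintro x -
  obtain ⟨y, rfl⟩ := (monomialIdeal k X).ringCon.mkₐ_surjective (α := k) x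
  have hy : y ∈ Submodule.span k (Set.range (PathAlgebra.ofPath k)) := by
    rw [← coe_pathAlgebraBasis, Basis.span_eq]
    trivial
  induction hy using Submodule.span_induction with
  | mem x hx =>
    obtain ⟨p, rfl⟩ := hx
    by_cases hp : PathAlgebra.ofPath k p ∈ monomialIdeal k X
    · rw [(mk_eq_zero_iff k X _).2 hp]
      exact Submodule.zero_mem _
    · exact Submodule.subset_span ⟨⟨p, hp⟩, rfl⟩
  | zero => rw [map_zero]; exact Submodule.zero_mem _
  | add x y _ _ hx hy => rw [map_add]; exact Submodule.add_mem _ hx hy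
  | smul c x _ hx => rw [map_smul]; exact Submodule.smul_mem _ c hx

variable {X} {n : ℕ} (ν : Fin n ≃ V)

/-- The nonzero paths form a path basis of a monomial algebra. -/
def monomialPathBasis (hX : ∀ p ∈ X, 2 ≤ p.length) :
    PathBasis k (vertexIdem k X ν) (NonzeroPath k X) where
  basis := Basis.mk (linearIndependent_pathClass k X) (span_pathClass k X)
  len p := p.1.length
  vert p t := ν.symm (p.1.vert t)
  triv i := ⟨QPath.trivial (ν i), trivial_notMem k hX _⟩
  basis_triv i := by simp [vertexIdem]
  len_triv i := by simp [QPath.trivial, QPath.length]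
  vert_triv i := by simp [QPath.vert, vertexAt_zero, QPath.trivial]
  eq_triv p hp := by
    refine Subtype.ext ?_
    rw [Equiv.apply_symm_apply, QPath.vert, vertexAt_zero]
    exact QPath.eq_trivial hp
  mul p q := by
    simp only [Basis.mk_apply]
    by_cases h : q.1.tgt = p.1.src
    · rw [pathClass_mul_of_eq k X _ _ h]
      by_cases hI : PathAlgebra.ofPath k (p.1.comp q.1 h) ∈ monomialIdeal k X
      · exact Or.inl (pathClass_eq_zero k X hI)
      · refine Or.inr ⟨⟨_, hI⟩, rfl, QPath.length_comp _ _ h, fun t ht => ?_, fun t ht => ?_⟩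
        · exact congrArg _ (QPath.vert_comp_left _ _ h ht)
        · exact congrArg _ (QPath.vert_comp_right _ _ h ht)
    · exact Or.inl (pathClass_mul_of_ne k X _ _ h)
  split p t ht := by
    obtain ⟨q, r, h, hp, hr⟩ := p.1.exists_eq_comp ht
    have hI := p.2
    rw [hp] at hI
    refine ⟨⟨q, fun hq => hI (comp_mem_left k q r h hq)⟩,
      ⟨r, fun hr => hI (comp_mem_right k q r h hr)⟩, ?_, hr⟩
    simp only [Basis.mk_apply]
    rw [pathClass_mul_of_eq k X _ _ h, hp]
  cancel p q p' q' he h0 hl := by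
    simp only [Basis.mk_apply] at he h0
    have h : q.1.tgt = p.1.src := by
      by_contra h
      exact h0 (pathClass_mul_of_ne k X _ _ h)
    have h' : q'.1.tgt = p'.1.src := by
      by_contra h'
      exact h0 (he.trans (pathClass_mul_of_ne k X _ _ h'))
    rw [pathClass_mul_of_eq k X _ _ h] at he h0
    rw [pathClass_mul_of_eq k X _ _ h'] at he
    have hI := mt (pathClass_eq_zero k X) h0
    have hI' := mt (pathClass_eq_zero k X) (he ▸ h0)
    have := (linearIndependent_pathClass k X).injective (a₁ := ⟨_, hI⟩) (a₂ := ⟨_, hI'⟩) he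
    obtain ⟨h1, h2⟩ := QPath.comp_cancel (h := h) (h' := h')
      (congrArg Subtype.val this) hl
    exact ⟨Subtype.ext h1, Subtype.ext h2⟩

theorem monomialPathBasis_basis (hX : ∀ p ∈ X, 2 ≤ p.length) (p : NonzeroPath k X) :
    (monomialPathBasis k ν hX).basis p = pathClass k X p.1 :=
  Basis.mk_apply _ (span_pathClass k X) p

theorem finite_nonzeroPath [∀ a b : V, Finite (a ⟶ b)] (hX : IsAdmissible k X) :
    Finite (NonzeroPath k X) := by
  obtain ⟨-, N, hN⟩ := hX
  refine ((QPath.finite_length_lt N).subset fun p hp => ?_).to_subtype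
  by_contra h
  exact hp (hN p (not_lt.1 h))

end MonomialBasis

/-! ### Arithmetic of a path basis: products, idempotents, characters and standard modules. -/

namespace PathBasis

open Module

variable {k : Type*} [Field k] {R : Type u} [Ring R] [Algebra k R] {n : ℕ} {e : Fin n → R}
  {ι : Type*} (P : PathBasis k e ι)

/-- The source of a path. -/
def src (p : ι) : Fin n := P.vert p 0

/-- The target of a path. -/
def tgt (p : ι) : Fin n := P.vert p (P.len p)

/-- The source of the path is the largest of its vertices. -/
def SourceMax (p : ι) : Prop := ∀ t ≤ P.len p, P.vert p t ≤ P.src p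

/-- The target of the path is the largest of its vertices. -/
def TargetMax (p : ι) : Prop := ∀ t ≤ P.len p, P.vert p t ≤ P.tgt p

theorem src_triv (i : Fin n) : P.src (P.triv i) = i := P.vert_triv i

theorem tgt_triv (i : Fin n) : P.tgt (P.triv i) = i := by rw [tgt, P.len_triv, P.vert_triv]

theorem eq_triv_src {p : ι} (hp : P.len p = 0) : p = P.triv (P.src p) := P.eq_triv p hp

theorem eq_triv_tgt {p : ι} (hp : P.len p = 0) : p = P.triv (P.tgt p) := by
  rw [tgt, hp]
  exact P.eq_triv p hp

theorem op_src (p : ι) : P.op.src p = P.tgt p := rfl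

theorem op_tgt (p : ι) : P.op.tgt p = P.src p := by
  change P.vert p (P.len p - P.len p) = _
  rw [Nat.sub_self]
  rfl

theorem op_len (p : ι) : P.op.len p = P.len p := rfl

theorem op_basis (p : ι) : P.op.basis p = MulOpposite.op (P.basis p) :=
  Basis.mulOpposite_apply ..

theorem op_sourceMax {p : ι} : P.op.SourceMax p ↔ P.TargetMax p := by
  constructor
  · intro h t ht
    have := h (P.len p - t) (Nat.sub_le _ _)
    change P.vert p (P.len p - (P.len p - t)) ≤ P.tgt p at this
    rwa [Nat.sub_sub_self ht] at this
  · intro h t ht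
    exact h _ (Nat.sub_le _ _)

theorem op_targetMax {p : ι} : P.op.TargetMax p ↔ P.SourceMax p := by
  rw [TargetMax, op_tgt]
  constructor
  · intro h t ht
    have := h (P.len p - t) (Nat.sub_le _ _)
    change P.vert p (P.len p - (P.len p - t)) ≤ P.src p at this
    rwa [Nat.sub_sub_self ht] at this
  · intro h t ht
    exact h _ (Nat.sub_le _ _)

section Mul

variable {P} {p q r : ι}

theorem mul_cases (p q : ι) :
    P.basis p * P.basis q = 0 ∨ ∃ r, P.basis p * P.basis q = P.basis r := by
  rcases P.mul p q with h | ⟨r, h, -⟩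
  exacts [Or.inl h, Or.inr ⟨r, h⟩]

theorem of_mul_eq (h : P.basis p * P.basis q = P.basis r) :
    P.len r = P.len q + P.len p ∧ (∀ t ≤ P.len q, P.vert r t = P.vert q t) ∧
      ∀ t ≤ P.len p, P.vert r (P.len q + t) = P.vert p t := by
  rcases P.mul p q with h0 | ⟨s, hs, h1⟩
  · exact absurd (h.symm.trans h0) (P.basis.ne_zero r)
  · obtain rfl := P.basis.injective (h.symm.trans hs)
    exact h1

theorem len_of_mul_eq (h : P.basis p * P.basis q = P.basis r) : P.len r = P.len q + P.len p :=
  (of_mul_eq h).1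

theorem vert_of_mul_eq (h : P.basis p * P.basis q = P.basis r) {t : ℕ} (ht : t ≤ P.len q) :
    P.vert r t = P.vert q t :=
  (of_mul_eq h).2.1 t ht

theorem vert_add_of_mul_eq (h : P.basis p * P.basis q = P.basis r) {t : ℕ} (ht : t ≤ P.len p) :
    P.vert r (P.len q + t) = P.vert p t :=
  (of_mul_eq h).2.2 t ht

theorem src_of_mul_eq (h : P.basis p * P.basis q = P.basis r) : P.src r = P.src q :=
  vert_of_mul_eq h (Nat.zero_le _)

theorem tgt_of_mul_eq (h : P.basis p * P.basis q = P.basis r) : P.tgt r = P.tgt p := by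
  rw [tgt, len_of_mul_eq h]
  exact vert_add_of_mul_eq h le_rfl

theorem tgt_eq_src_of_mul_eq (h : P.basis p * P.basis q = P.basis r) : P.tgt q = P.src p := by
  rw [tgt, ← vert_of_mul_eq h le_rfl]
  exact vert_add_of_mul_eq h (Nat.zero_le _)

theorem tgt_eq_src_of_mul_ne_zero (h : P.basis p * P.basis q ≠ 0) : P.tgt q = P.src p := by
  obtain ⟨r, hr⟩ := (mul_cases p q).resolve_left h
  exact tgt_eq_src_of_mul_eq hr

/-- A vertex of a product is a vertex of one of the factors. -/
theorem vert_mem_of_mul_eq (h : P.basis p * P.basis q = P.basis r) {t : ℕ} (ht : t ≤ P.len r) :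
    (∃ s ≤ P.len q, P.vert r t = P.vert q s) ∨ ∃ s ≤ P.len p, P.vert r t = P.vert p s := by
  rw [len_of_mul_eq h] at ht
  by_cases hq : t ≤ P.len q
  · exact Or.inl ⟨t, hq, vert_of_mul_eq h hq⟩
  · refine Or.inr ⟨t - P.len q, by omega, ?_⟩
    rw [← vert_add_of_mul_eq h (by omega)]
    congr 1
    omega

end Mul

/-- Idempotency is not an axiom of `PathBasis`. Splitting the trivial path at `0` yields two factors
of length zero, both of which must be that same trivial path. -/
theorem idem_mul_self (P : PathBasis k e ι) (i : Fin n) : e i * e i = e i := by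
  obtain ⟨q, r, h, hr⟩ := P.split (P.triv i) 0 (Nat.zero_le _)
  have hl := len_of_mul_eq h
  rw [P.len_triv, hr, zero_add] at hl
  have h1 := P.eq_triv_tgt hl.symm
  have h2 := P.eq_triv_src hr
  rw [← tgt_of_mul_eq h, tgt_triv] at h1
  rw [← src_of_mul_eq h, src_triv] at h2
  rwa [h1, h2, basis_triv] at h

theorem idem_mul_basis (p : ι) : e (P.tgt p) * P.basis p = P.basis p := by
  obtain ⟨q, r, h, hr⟩ := P.split p (P.len p) le_rfl
  have hl := len_of_mul_eq h
  rw [hr] at hl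
  have h1 := P.eq_triv_tgt (show P.len q = 0 by omega)
  rw [← tgt_of_mul_eq h] at h1
  rw [← h, h1, basis_triv, ← mul_assoc, idem_mul_self P]

theorem basis_mul_idem (p : ι) : P.basis p * e (P.src p) = P.basis p := by
  obtain ⟨q, r, h, hr⟩ := P.split p 0 (Nat.zero_le _)
  have h1 := P.eq_triv_src hr
  rw [← src_of_mul_eq h] at h1
  rw [← h, h1, basis_triv, mul_assoc, idem_mul_self P]

theorem idem_mul_basis_of_ne {p : ι} {i : Fin n} (h : P.tgt p ≠ i) : e i * P.basis p = 0 := by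
  rw [← P.basis_triv]
  by_contra h0
  exact h ((tgt_eq_src_of_mul_ne_zero h0).trans (P.src_triv i))

theorem basis_mul_idem_of_ne {p : ι} {i : Fin n} (h : P.src p ≠ i) : P.basis p * e i = 0 := by
  rw [← P.basis_triv]
  by_contra h0
  exact h ((P.tgt_triv i).symm.trans (tgt_eq_src_of_mul_ne_zero h0)).symm

theorem sum_idem (P : PathBasis k e ι) : ∑ i, e i = 1 := by
  have h : LinearMap.mulLeft k (∑ i, e i) = LinearMap.id := by
    refine P.basis.ext fun p => ?_
    rw [LinearMap.mulLeft_apply, Finset.sum_mul, Finset.sum_eq_single (P.tgt p),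
      P.idem_mul_basis, LinearMap.id_apply]
    · exact fun i _ hi => P.idem_mul_basis_of_ne hi.symm
    · simp
  simpa using LinearMap.congr_fun h 1

/-! ### Subspaces spanned by paths -/

/-- The subspace spanned by a set of paths. -/
def span (T : Set ι) : Submodule k R := Submodule.span k (P.basis '' T)

variable {P}

/-- Membership is tested coefficientwise, so intersecting spans of paths amounts to intersecting the
sets. -/
theorem mem_span {T : Set ι} {x : R} : x ∈ P.span T ↔ ∀ p, P.basis.repr x p ≠ 0 → p ∈ T := by
  rw [span, Basis.mem_span_image]
  simp only [Set.subset_def, Finset.mem_coe, Finsupp.mem_support_iff]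

theorem basis_mem_span {T : Set ι} {p : ι} : P.basis p ∈ P.span T ↔ p ∈ T :=
  P.basis.self_mem_span_image

theorem idem_mem_span {T : Set ι} {i : Fin n} : e i ∈ P.span T ↔ P.triv i ∈ T := by
  rw [← P.basis_triv, basis_mem_span]

theorem mem_span_univ (x : R) : x ∈ P.span Set.univ := mem_span.2 fun _ _ => trivial

theorem span_le {T : Set ι} {U : Submodule k R} : P.span T ≤ U ↔ ∀ p ∈ T, P.basis p ∈ U := by
  rw [span, Submodule.span_le]
  exact Set.image_subset_iff

theorem span_mono {S T : Set ι} (h : S ⊆ T) : P.span S ≤ P.span T :=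
  Submodule.span_mono (Set.image_mono h)

theorem mul_mem_of_basis {S T : Set ι} {U : Submodule k R}
    (h : ∀ p ∈ S, ∀ q ∈ T, P.basis p * P.basis q ∈ U) {x y : R} (hx : x ∈ P.span S)
    (hy : y ∈ P.span T) : x * y ∈ U := by
  have := Submodule.mul_mem_mul hx hy
  rw [span, span, Submodule.span_mul_span] at this
  refine (Submodule.span_le.2 ?_) this
  rintro _ ⟨_, ⟨p, hp, rfl⟩, _, ⟨q, hq, rfl⟩, rfl⟩
  exact h p hp q hq

theorem mul_mem_span {S T U : Set ι}
    (h : ∀ p ∈ S, ∀ q ∈ T, ∀ r, P.basis p * P.basis q = P.basis r → r ∈ U) {x y : R}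
    (hx : x ∈ P.span S) (hy : y ∈ P.span T) : x * y ∈ P.span U := by
  refine mul_mem_of_basis (fun p hp q hq => ?_) hx hy
  rcases mul_cases (P := P) p q with h0 | ⟨r, hr⟩
  · rw [h0]; exact Submodule.zero_mem _
  · rw [hr, basis_mem_span]; exact h p hp q hq r hr

theorem idem_mul_mem {T : Set ι} {x : R} (hx : x ∈ P.span T) (i : Fin n) :
    e i * x ∈ P.span {p | p ∈ T ∧ P.tgt p = i} := by
  refine mul_mem_of_basis (S := {P.triv i}) (fun p hp q hq => ?_)
    (idem_mem_span.2 (Set.mem_singleton _)) hx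
  rw [hp, P.basis_triv]
  by_cases h : P.tgt q = i
  · rw [← h, P.idem_mul_basis, basis_mem_span]
    exact ⟨hq, rfl⟩
  · rw [P.idem_mul_basis_of_ne h]
    exact Submodule.zero_mem _

theorem mul_idem_mem {T : Set ι} {x : R} (hx : x ∈ P.span T) (i : Fin n) :
    x * e i ∈ P.span {p | p ∈ T ∧ P.src p = i} := by
  refine mul_mem_of_basis (T := {P.triv i}) (fun p hp q hq => ?_) hx
    (idem_mem_span.2 (Set.mem_singleton _))
  rw [hq, P.basis_triv]
  by_cases h : P.src p = i
  · rw [← h, P.basis_mul_idem, basis_mem_span]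
    exact ⟨hp, rfl⟩
  · rw [P.basis_mul_idem_of_ne h]
    exact Submodule.zero_mem _

variable (P)

/-! ### The characters -/

/-- Lengths add, so a product of paths is trivial only if both factors are. -/
theorem repr_triv_mul (i : Fin n) (x y : R) :
    P.basis.repr (x * y) (P.triv i) = P.basis.repr x (P.triv i) * P.basis.repr y (P.triv i) := by
  classical
  have h : (LinearMap.mul k R).compr₂ (P.basis.coord (P.triv i)) =
      (LinearMap.mul k k).compl₁₂ (P.basis.coord (P.triv i)) (P.basis.coord (P.triv i)) := by
    refine P.basis.ext fun p => P.basis.ext fun q => ?_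
    simp only [LinearMap.compr₂_apply, LinearMap.mul_apply', LinearMap.compl₁₂_apply,
      Basis.coord_apply, Basis.repr_self, Finsupp.single_apply]
    by_cases h : p = P.triv i ∧ q = P.triv i
    · rw [h.1, h.2, if_pos rfl, basis_triv, P.idem_mul_self, ← P.basis_triv, Basis.repr_self,
        Finsupp.single_eq_same, mul_one]
    · have h1 : ((if p = P.triv i then (1 : k) else 0) * if q = P.triv i then 1 else 0) = 0 := by
        rw [ite_zero_mul_ite_zero, if_neg h]
      rw [h1]
      rcases P.mul_cases p q with h0 | ⟨r, hr⟩
      · rw [h0]; simp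
      · rw [hr, Basis.repr_self, Finsupp.single_apply, if_neg]
        rintro rfl
        apply h
        have hl := len_of_mul_eq hr
        rw [P.len_triv] at hl
        have hp := P.eq_triv_tgt (show P.len p = 0 by omega)
        have hq := P.eq_triv_src (show P.len q = 0 by omega)
        rw [← tgt_of_mul_eq hr, tgt_triv] at hp
        rw [← src_of_mul_eq hr, src_triv] at hq
        exact ⟨hp, hq⟩
  exact LinearMap.congr_fun (LinearMap.congr_fun h x) y

theorem triv_injective : Function.Injective P.triv := fun i j h => by
  rw [← P.src_triv i, h, P.src_triv]

/-- The character of `R` at a vertex: the coefficient of the trivial path. -/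
def char (i : Fin n) : R →ₐ[k] k :=
  AlgHom.ofLinearMap (P.basis.coord (P.triv i))
    (by
      rw [Basis.coord_apply, ← P.sum_idem, map_sum, Finsupp.finsetSum_apply,
        Finset.sum_eq_single i]
      · rw [← P.basis_triv, Basis.repr_self, Finsupp.single_eq_same]
      · intro j _ hj
        rw [← P.basis_triv, Basis.repr_self, Finsupp.single_eq_of_ne]
        exact fun h => hj (P.triv_injective h).symm
      · simp)
    (P.repr_triv_mul i)

theorem char_apply (i : Fin n) (x : R) : P.char i x = P.basis.repr x (P.triv i) := rfl

theorem char_idem (i j : Fin n) : P.char i (e j) = if i = j then 1 else 0 := by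
  classical
  rw [char_apply, ← P.basis_triv, Basis.repr_self, Finsupp.single_apply]
  simp [P.triv_injective.eq_iff, eq_comm]

theorem char_eq_zero_iff {x : R} : (∀ i, P.char i x = 0) ↔ x ∈ P.span {p | 0 < P.len p} := by
  rw [mem_span]
  constructor
  · intro h p hp
    rw [Set.mem_ofPred_eq, Nat.pos_iff_ne_zero]
    intro h0
    rw [P.eq_triv_src h0] at hp
    exact hp (h _)
  · intro h i
    rw [char_apply]
    by_contra h0
    have := h _ h0
    simp [P.len_triv] at this

theorem pow_mem_span {x : R} (hx : x ∈ P.span {p | 0 < P.len p}) (m : ℕ) :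
    x ^ m ∈ P.span {p | m ≤ P.len p} := by
  induction m with
  | zero => exact span_mono (by simp) (mem_span_univ _)
  | succ m ih =>
    rw [pow_succ]
    refine mul_mem_span (fun p hp q hq r h => ?_) ih hx
    have := len_of_mul_eq h
    simp only [Set.mem_ofPred_eq] at hp hq ⊢
    omega

theorem isNilpotent [Finite ι] {x : R} (hx : x ∈ P.span {p | 0 < P.len p}) : IsNilpotent x := by
  obtain ⟨N, hN⟩ := (Set.finite_range P.len).bddAbove
  refine ⟨N + 1, ?_⟩
  have := P.pow_mem_span hx (N + 1)
  rw [mem_span] at this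
  refine (map_eq_zero_iff P.basis.repr P.basis.repr.injective).1 (Finsupp.ext fun p => ?_)
  by_contra h
  exact absurd (hN ⟨p, rfl⟩) (not_le.2 (this p h))

theorem isSplitBasic [Finite ι] : IsSplitBasic P.char e where
  nil _ hx := P.isNilpotent (P.char_eq_zero_iff.1 hx)
  idem := P.idem_mul_self
  apply := P.char_idem

/-- Nilpotency can be tested in `R`, so one argument describes radicals and simple modules of every
subalgebra that contains the idempotents. -/
theorem isSplitBasic_subalgebra [Finite ι] (B : Subalgebra k R) (hB : ∀ i, e i ∈ B) :
    IsSplitBasic (fun i => (P.char i).comp B.val) (fun i => (⟨e i, hB i⟩ : B)) where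
  nil x hx := by
    have := P.isSplitBasic.nil x hx
    exact (IsNilpotent.map_iff (f := B.val) Subtype.val_injective).1 this
  idem i := Subtype.ext (P.idem_mul_self i)
  apply := P.char_idem

/-! ### Standard modules -/

theorem mem_proj_iff {i : Fin n} {x : R} : x ∈ proj R e i ↔ x ∈ P.span {p | P.src p = i} := by
  rw [Submodule.mem_span_singleton]
  constructor
  · rintro ⟨a, rfl⟩
    exact span_mono (fun p hp => hp.2) (mul_idem_mem (mem_span_univ a) i)
  · intro hx
    refine ⟨x, ?_⟩
    have h : P.span {p | P.src p = i} ≤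
        LinearMap.ker (LinearMap.mulRight k (e i) - LinearMap.id) := by
      refine span_le.2 fun p hp => ?_
      obtain rfl : P.src p = i := hp
      simp [P.basis_mul_idem]
    exact sub_eq_zero.1 (h hx)

/-- The kernel is generated by the paths from `i` that end above `i`; their left multiples are the
paths from `i` that visit a vertex above `i`. Hence the `SourceMax` paths from `i` give a basis of
Δ_i. -/
theorem mem_standardKernel_iff [Finite ι] {i : Fin n} {x : proj R e i} :
    x ∈ standardKernel R e i ↔ (x : R) ∈ P.span {p | ¬ P.SourceMax p} := by
  rw [P.isSplitBasic.standardKernel_eq]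
  constructor
  · intro hx
    induction hx using Submodule.span_induction with
    | mem y hy =>
      obtain ⟨j, hj, hy⟩ := hy
      have h1 := idem_mul_mem (P.mem_proj_iff.1 y.2) j
      rw [show e j * (y : R) = y from congrArg Subtype.val hy] at h1
      refine span_mono ?_ h1
      rintro p ⟨hp, hpj⟩ hmax
      obtain rfl : P.src p = i := hp
      obtain rfl : P.tgt p = j := hpj
      exact absurd (hmax _ le_rfl) (not_le.2 hj)
    | zero => exact Submodule.zero_mem _
    | add y z _ _ hy hz => exact Submodule.add_mem _ hy hz
    | smul a y _ hy =>
      refine mul_mem_span (fun p _ q hq r h hr => ?_) (mem_span_univ a) hy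
      refine hq fun t ht => ?_
      rw [← vert_of_mul_eq h ht, ← src_of_mul_eq h]
      refine hr t ?_
      rw [len_of_mul_eq h]
      omega
  · intro hx
    have hx' : (x : R) ∈ P.span {p | P.src p = i ∧ ¬ P.SourceMax p} := by
      have h1 := P.mem_proj_iff.1 x.2
      rw [mem_span] at hx h1 ⊢
      exact fun p hp => ⟨h1 p hp, hx p hp⟩
    have h : P.span {p | P.src p = i ∧ ¬ P.SourceMax p} ≤ ((Submodule.span R
        {y : proj R e i | ∃ j, i < j ∧ e j • y = y}).map (proj R e i).subtype).restrictScalars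
          k := by
      refine span_le.2 ?_
      rintro p ⟨rfl, hp⟩
      rw [SourceMax] at hp
      push Not at hp
      obtain ⟨t, ht, hlt⟩ := hp
      -- Cut where the path is above its source: the initial piece `r` is one of the generators.
      obtain ⟨q, r, hqr, hr⟩ := P.split p t ht
      have hri : P.basis r ∈ proj R e (P.src p) := by
        rw [P.mem_proj_iff, basis_mem_span]
        exact (src_of_mul_eq hqr).symm
      refine ⟨P.basis q • ⟨P.basis r, hri⟩, ?_, hqr⟩
      refine Submodule.smul_mem _ _ (Submodule.subset_span ⟨P.tgt r, ?_, ?_⟩)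
      · rwa [tgt, ← vert_of_mul_eq hqr le_rfl, hr]
      · exact Subtype.ext (P.idem_mul_basis r)
    obtain ⟨y, hy, hyx⟩ := h hx'
    rwa [show x = y from Subtype.ext hyx.symm]

/-- If the endomorphism rings of the standard modules are the ground field, then a nontrivial
closed path passes through a vertex larger than its source. -/
theorem len_eq_zero_of_end [Finite ι]
    (hE : ∀ i, Nonempty (Module.End R (standard R e i) ≃ₐ[k] k)) {p : ι} (hp : P.SourceMax p)
    (ht : P.tgt p = P.src p) : P.len p = 0 := by
  by_contra hl
  have hpi : P.basis p ∈ proj R e (P.src p) := by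
    rw [P.mem_proj_iff, basis_mem_span]
    rfl
  -- Right multiplication by `p`. It preserves the standard kernel, and it induces a nilpotent
  -- endomorphism of Δ because `p` is nilpotent. In a field this must be zero, yet it sends the
  -- class of the idempotent to the class of `p`, which is nonzero for a `SourceMax` path.
  let g : proj R e (P.src p) →ₗ[R] proj R e (P.src p) :=
    (LinearMap.toSpanSingleton R _ ⟨P.basis p, hpi⟩).comp (proj R e (P.src p)).subtype
  have hg : ∀ x, (g x : R) = x * P.basis p := fun x => rfl
  have hK : standardKernel R e (P.src p) ≤ (standardKernel R e (P.src p)).comap g := by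
    intro x hx
    have hxi := P.mem_proj_iff.1 x.2
    rw [Submodule.mem_comap, P.mem_standardKernel_iff, hg]
    rw [P.mem_standardKernel_iff] at hx
    have hx' : (x : R) ∈ P.span {q | P.src q = P.src p ∧ ¬ P.SourceMax q} := by
      rw [mem_span] at hx hxi ⊢
      exact fun p hp => ⟨hxi p hp, hx p hp⟩
    refine mul_mem_span (T := {p}) ?_ hx' (basis_mem_span.2 (Set.mem_singleton _))
    rintro q ⟨hq, hqm⟩ _ rfl r hr hrm
    refine hqm fun t ht => ?_
    rw [← vert_add_of_mul_eq hr ht, hq, ← src_of_mul_eq hr]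
    refine hrm _ ?_
    rw [len_of_mul_eq hr]
    omega
  let f : Module.End R (standard R e (P.src p)) := Submodule.mapQ _ _ g hK
  have hf : ∀ (m : ℕ) (x : proj R e (P.src p)), (x : R) * P.basis p ^ m = 0 →
      (f ^ m) (Submodule.Quotient.mk x) = 0 := by
    intro m
    induction m with
    | zero =>
      intro x hx
      obtain rfl : x = 0 := Subtype.ext (by simpa using hx)
      exact map_zero _
    | succ m ih =>
      intro x hx
      rw [pow_succ, Module.End.mul_apply]
      refine ih (g x) ?_
      rw [hg, mul_assoc, ← pow_succ', hx]
  obtain ⟨N, hN⟩ := P.isNilpotent (x := P.basis p) (basis_mem_span.2 (Nat.pos_of_ne_zero hl))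
  have hfN : f ^ N = 0 := by
    refine LinearMap.ext fun x => ?_
    obtain ⟨y, rfl⟩ := Submodule.Quotient.mk_surjective _ x
    exact hf N y (by rw [hN, mul_zero])
  obtain ⟨Φ⟩ := hE (P.src p)
  have hf0 : f = 0 := by
    refine Φ.injective ?_
    rw [map_zero]
    exact IsNilpotent.eq_zero ⟨N, by rw [← map_pow, hfN, map_zero]⟩
  have h1 : f (Submodule.Quotient.mk ⟨e (P.src p), Submodule.mem_span_singleton_self _⟩) = 0 := by
    rw [hf0]
    rfl
  have h2 : f (Submodule.Quotient.mk ⟨e (P.src p), Submodule.mem_span_singleton_self _⟩) =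
      Submodule.Quotient.mk (g ⟨e (P.src p), Submodule.mem_span_singleton_self _⟩) := rfl
  rw [h2, Submodule.Quotient.mk_eq_zero, P.mem_standardKernel_iff, hg] at h1
  change e (P.src p) * P.basis p ∈ _ at h1
  rw [← ht, P.idem_mul_basis, basis_mem_span] at h1
  exact h1 hp

end PathBasis

/-! ### Factorization at a largest vertex, and counting the layers of a standard filtration. -/

namespace PathBasis

open Module

variable {k : Type*} [Field k] {R : Type u} [Ring R] [Algebra k R] {n : ℕ} {e : Fin n → R}
  {ι : Type*} (P : PathBasis k e ι)

/-- A nontrivial closed path passes through a vertex larger than its source. -/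
def NoReturn : Prop := ∀ p, P.SourceMax p → P.tgt p = P.src p → P.len p = 0

/-- Every path factors at a largest vertex. -/
theorem exists_factorization (p : ι) :
    ∃ c b, P.SourceMax c ∧ P.TargetMax b ∧ P.basis c * P.basis b = P.basis p := by
  obtain ⟨t, ht, hmax⟩ := Finset.exists_max_image (Finset.range (P.len p + 1)) (P.vert p)
    ⟨0, by simp⟩
  simp only [Finset.mem_range, Nat.lt_succ_iff] at ht hmax
  obtain ⟨c, b, h, hb⟩ := P.split p t ht
  have hl := len_of_mul_eq h
  refine ⟨c, b, fun s hs => ?_, fun s hs => ?_, h⟩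
  · rw [← tgt_eq_src_of_mul_eq h, tgt, ← vert_of_mul_eq h le_rfl, hb, ← vert_add_of_mul_eq h hs]
    exact hmax _ (by omega)
  · rw [tgt, ← vert_of_mul_eq h le_rfl, hb, ← vert_of_mul_eq h hs]
    exact hmax _ (by omega)

theorem finite (P : PathBasis k e ι) [Finite ι] : Module.Finite k R := Module.Finite.of_basis P.basis

theorem finrank_span [Finite ι] (T : Set ι) : finrank k (P.span T) = Nat.card T := by
  classical
  have := Fintype.ofFinite T
  have h : LinearIndependent k fun p : T => P.basis p :=
    P.basis.linearIndependent.comp _ Subtype.val_injective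
  have h1 := finrank_span_eq_card h
  have h2 : Set.range (fun p : T => P.basis p) = P.basis '' T := by
    rw [Set.image_eq_range]
  rw [h2] at h1
  rw [span, h1, Nat.card_eq_fintype_card]

/-- The standard kernel involves no `SourceMax` path, so these stay independent modulo it. The count
needs only this inequality. -/
theorem card_le_finrank_standard [Finite ι] (j : Fin n) :
    Nat.card {c | P.SourceMax c ∧ P.src c = j} ≤ finrank k (standard R e j) := by
  have := P.finite
  rw [← P.finrank_span]
  have h1 : Module.Finite k (proj R e j) :=
    Module.Finite.of_injective ((proj R e j).subtype.restrictScalars k) Subtype.val_injective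
  have h2 : Module.Finite k (standard R e j) :=
    Module.Finite.of_surjective ((standardKernel R e j).mkQ.restrictScalars k)
      (standardKernel R e j).mkQ_surjective
  let f : P.span {c | P.SourceMax c ∧ P.src c = j} →ₗ[k] proj R e j :=
    { toFun := fun x => ⟨x, P.mem_proj_iff.2 (span_mono (fun c hc => hc.2) x.2)⟩
      map_add' := fun _ _ => rfl
      map_smul' := fun _ _ => rfl }
  refine LinearMap.finrank_le_finrank_of_injective
    (f := ((standardKernel R e j).mkQ.restrictScalars k).comp f) ?_
  rw [← LinearMap.ker_eq_bot, LinearMap.ker_eq_bot']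
  intro x hx
  have hx : f x ∈ standardKernel R e j := (Submodule.Quotient.mk_eq_zero _).1 hx
  rw [P.mem_standardKernel_iff, mem_span] at hx
  have hx' := mem_span.1 x.2
  refine Subtype.ext ((map_eq_zero_iff P.basis.repr P.basis.repr.injective).1
    (Finsupp.ext fun p => ?_))
  by_contra h
  exact hx p h (hx' p h).1

/-- The subspace spanned by all paths but those that end at `i`, their largest vertex. -/
def topKernel (i : Fin n) : Submodule k R := P.span {p | ¬ (P.TargetMax p ∧ P.tgt p = i)}

/-- Together with `mul_idem_mul_mem_topKernel`: modulo `topKernel i` only `e i * x` matters, and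
whatever passes through a vertex above `i` vanishes. The quotient of `R` by `topKernel i` thus
detects the layers Δ_i. -/
theorem sub_idem_mul_mem_topKernel (i : Fin n) (x : R) : x - e i * x ∈ P.topKernel i := by
  have h : P.span Set.univ ≤ (P.topKernel i).comap (LinearMap.id - LinearMap.mulLeft k (e i)) := by
    refine span_le.2 fun p _ => ?_
    rw [Submodule.mem_comap, LinearMap.sub_apply, LinearMap.id_apply, LinearMap.mulLeft_apply]
    by_cases hp : P.tgt p = i
    · rw [← hp, P.idem_mul_basis, sub_self]
      exact Submodule.zero_mem _
    · rw [P.idem_mul_basis_of_ne hp, sub_zero, topKernel, basis_mem_span]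
      exact fun h => hp h.2
  exact h (mem_span_univ x)

theorem mul_idem_mul_mem_topKernel {i j : Fin n} (hij : i < j) (x y : R) :
    x * e j * y ∈ P.topKernel i := by
  refine mul_mem_span ?_ (mul_idem_mem (mem_span_univ x) j) (mem_span_univ y)
  rintro p ⟨-, hp⟩ q - r h ⟨hm, hr⟩
  have h1 := hm (P.len q) (by rw [len_of_mul_eq h]; omega)
  rw [hr, vert_of_mul_eq h le_rfl] at h1
  change P.tgt q ≤ i at h1
  rw [tgt_eq_src_of_mul_eq h, hp] at h1
  exact absurd h1 (not_le.2 hij)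

theorem idem_smul_standard_of_lt (P : PathBasis k e ι) [Finite ι] {i j : Fin n} (hij : j < i) (x : standard R e j) :
    e i • x = 0 := by
  obtain ⟨a, rfl⟩ := Submodule.Quotient.mk_surjective _ x
  rw [← Submodule.Quotient.mk_smul, Submodule.Quotient.mk_eq_zero, P.mem_standardKernel_iff]
  refine span_mono ?_ (idem_mul_mem (P.mem_proj_iff.1 a.2) i)
  rintro p ⟨hp, hpi⟩ hm
  obtain rfl : P.src p = j := hp
  have := hm _ le_rfl
  change P.tgt p ≤ _ at this
  rw [hpi] at this
  exact absurd this (not_le.2 hij)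

variable {P} in
-- e_i Δ_i has as basis the closed `SourceMax` paths at `i`, and `NoReturn` leaves only the trivial
-- one.
theorem NoReturn.idem_smul_standard [Finite ι] (h : P.NoReturn) (i : Fin n)
    (x : standard R e i) : ∃ c : k, e i • x = algebraMap k R c •
      Submodule.Quotient.mk ⟨e i, Submodule.mem_span_singleton_self _⟩ := by
  obtain ⟨a, rfl⟩ := Submodule.Quotient.mk_surjective _ x
  refine ⟨P.char i (e i * a), ?_⟩
  rw [← Submodule.Quotient.mk_smul, ← Submodule.Quotient.mk_smul, ← sub_eq_zero,
    ← Submodule.Quotient.mk_sub, Submodule.Quotient.mk_eq_zero, P.mem_standardKernel_iff, mem_span]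
  intro p hp hm
  have h1 := mem_span.1 (idem_mul_mem (P.mem_proj_iff.1 a.2) i) p
  change P.basis.repr (e i * a - algebraMap k R (P.char i (e i * a)) * e i) p ≠ 0 at hp
  rw [← Algebra.smul_def, map_sub, map_smul, ← P.basis_triv, Basis.repr_self, P.basis_triv,
    Finsupp.sub_apply, Finsupp.smul_apply] at hp
  by_cases hpi : p = P.triv i
  · rw [hpi, Finsupp.single_eq_same, smul_eq_mul, mul_one, char_apply, sub_self] at hp
    exact hp rfl
  · rw [Finsupp.single_eq_of_ne hpi, smul_zero, sub_zero] at hp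
    obtain ⟨hsrc, htgt⟩ := h1 hp
    have hsrc : P.src p = i := hsrc
    exact hpi (by rw [P.eq_triv_src (h p hm (htgt.trans hsrc.symm)), hsrc])

theorem exists_surjective_of_equiv {M S : Type*} [AddCommGroup M] [Module R M] [AddCommGroup S]
    [Module R S] {N N' : Submodule R M} (φ : (N' ⧸ N.submoduleOf N') ≃ₗ[R] S) :
    ∃ g : N' →ₗ[R] S, Function.Surjective g ∧ ∀ x, g x = 0 ↔ (x : M) ∈ N := by
  refine ⟨φ.toLinearMap.comp (N.submoduleOf N').mkQ,
    φ.surjective.comp (Submodule.mkQ_surjective _), fun x => ?_⟩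
  rw [LinearMap.comp_apply, LinearEquiv.coe_coe, LinearEquiv.map_eq_zero_iff,
    Submodule.mkQ_apply, Submodule.Quotient.mk_eq_zero]
  rfl

theorem finrank_eq_add_of_surjective [Module.Finite k R] {S : Type*} [AddCommGroup S] [Module R S]
    [Module k S] [IsScalarTower k R S] {N N' : Submodule R R} (hN : N ≤ N') (g : N' →ₗ[R] S)
    (hg : Function.Surjective g) (hker : ∀ x, g x = 0 ↔ (x : R) ∈ N) :
    finrank k (N'.restrictScalars k) = finrank k (N.restrictScalars k) + finrank k S := by
  let f : N'.restrictScalars k →ₗ[k] S := g.restrictScalars k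
  have h1 : LinearMap.ker f =
      (N.restrictScalars k).comap (N'.restrictScalars k).subtype := by
    ext x
    exact hker x
  have h2 := f.finrank_range_add_finrank_ker
  rw [LinearMap.range_eq_top.2 (show Function.Surjective f from hg), finrank_top, h1,
    (Submodule.comapSubtypeEquivOfLe (p := N.restrictScalars k) (q := N'.restrictScalars k)
      hN).finrank_eq] at h2
  rw [← h2, add_comm]

variable {P} in
-- A layer Δ_j enlarges the image of the filtration in `R / topKernel i` by at most a line if `j =
-- i`, as e_i Δ_i is one-dimensional, and not at all otherwise. For `j < i` this holds because e_i
-- Δ_j = 0; for `i < j` because Δ_j is generated by its vertex `j` and `R e_j R` lies in `topKernel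
-- i`.
theorem NoReturn.finrank_sup_topKernel_le [Finite ι] (h : P.NoReturn) {i j : Fin n}
    {N N' : Submodule R R} (g : N' →ₗ[R] standard R e j) (hg : Function.Surjective g)
    (hker : ∀ x, g x = 0 ↔ (x : R) ∈ N) :
    finrank k (N'.restrictScalars k ⊔ P.topKernel i : Submodule k R) ≤
      finrank k (N.restrictScalars k ⊔ P.topKernel i : Submodule k R) +
        if j = i then 1 else 0 := by
  have := P.finite
  obtain ⟨y, hy⟩ := hg (Submodule.Quotient.mk ⟨e j, Submodule.mem_span_singleton_self _⟩)
  have key : ∀ x z : N', g x = g z → (x : R) - z ∈ N := fun x z hxz =>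
    (hker (x - z)).1 (by rw [map_sub, hxz, sub_self])
  have hsplit : ∀ a b c : R, a - b ∈ N → b ∈ P.topKernel i ⊔ Submodule.span k {c} →
      a ∈ (N.restrictScalars k ⊔ P.topKernel i) ⊔ Submodule.span k {c} := by
    intro a b c hab hb
    rw [← sub_add_cancel a b, sup_assoc]
    exact Submodule.add_mem_sup hab hb
  split_ifs with hij
  · subst hij
    have hle : N'.restrictScalars k ⊔ P.topKernel j ≤
        (N.restrictScalars k ⊔ P.topKernel j) ⊔ Submodule.span k {(y : R)} := by
      refine sup_le (fun x hx => ?_) (le_sup_right.trans le_sup_left)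
      obtain ⟨c, hc⟩ := h.idem_smul_standard j (g ⟨x, hx⟩)
      rw [← hy, ← map_smul, ← map_smul] at hc
      have h1 := key _ _ hc
      refine hsplit x (x - e j * x + algebraMap k R c * y) y ?_ ?_
      · convert h1 using 1
        change _ = e j * x - algebraMap k R c * y
        abel
      · refine Submodule.add_mem_sup (P.sub_idem_mul_mem_topKernel j x) ?_
        rw [← Algebra.smul_def]
        exact Submodule.smul_mem _ _ (Submodule.mem_span_singleton_self _)
    refine (Submodule.finrank_mono hle).trans ((Submodule.finrank_add_le_finrank_add_finrank _ _).trans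
      (Nat.add_le_add_left ?_ _))
    exact (finrank_span_le_card _).trans (by simp)
  · rw [add_zero]
    refine Submodule.finrank_mono (sup_le (fun x hx => ?_) le_sup_right)
    have h0 : ∀ a b : R, a - b ∈ N → b ∈ P.topKernel i →
        a ∈ N.restrictScalars k ⊔ P.topKernel i := by
      intro a b hab hb
      rw [← sub_add_cancel a b]
      exact Submodule.add_mem_sup hab hb
    rcases lt_or_gt_of_ne hij with hlt | hlt
    · refine h0 x (x - e i * x) ?_ (P.sub_idem_mul_mem_topKernel i x)
      rw [sub_sub_cancel]
      refine (hker (e i • ⟨x, hx⟩)).1 ?_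
      rw [map_smul, P.idem_smul_standard_of_lt hlt]
    · obtain ⟨a, ha⟩ := Submodule.Quotient.mk_surjective _ (g ⟨x, hx⟩)
      refine h0 x (a * e j * y) ?_ (P.mul_idem_mul_mem_topKernel hlt _ _)
      refine key ⟨x, hx⟩ (((a : R) * e j) • y) ?_
      rw [map_smul, hy, ← ha, ← Submodule.Quotient.mk_smul]
      congr 1
      refine Subtype.ext ?_
      change (a : R) = a * e j * e j
      rw [mul_assoc, P.idem_mul_self]
      exact (P.isSplitBasic.mem_proj.1 a.2).symm

/-- In a quasi-hereditary algebra, the product of a path that starts at its largest vertex with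
a path that ends there, as its largest vertex, is nonzero. -/
theorem mul_ne_zero_of_filtered [Finite ι] (h : P.NoReturn) (hF : IsStandardFiltered R e R)
    {c b : ι} (hc : P.SourceMax c) (hb : P.TargetMax b) (hcb : P.tgt b = P.src c) :
    P.basis c * P.basis b ≠ 0 := by
  classical
  have := P.finite
  have := Fintype.ofFinite ι
  have : Nonempty (Fin n) := ⟨P.src c⟩
  obtain ⟨m, F, hF0, hFm, hFs⟩ := hF
  -- Layers beyond `m` receive an arbitrary index, so that `idx` is defined on all of `ℕ`.
  have hFs' : ∀ t, ∃ j, t < m → F t ≤ F (t + 1) ∧ ∃ g : F (t + 1) →ₗ[R] standard R e j,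
      Function.Surjective g ∧ ∀ x, g x = 0 ↔ (x : R) ∈ F t := by
    intro t
    by_cases ht : t < m
    · obtain ⟨hle, j, ⟨φ⟩⟩ := hFs t ht
      exact ⟨j, fun _ => ⟨hle, exists_surjective_of_equiv φ⟩⟩
    · exact ⟨Classical.arbitrary _, fun h => absurd h ht⟩
  choose idx hidx using hFs'
  have hdim : ∀ t ≤ m, finrank k ((F t).restrictScalars k) =
      ∑ s ∈ Finset.range t, finrank k (standard R e (idx s)) := by
    intro t
    induction t with
    | zero =>
      intro _
      rw [hF0, Finset.range_zero, Finset.sum_empty, Submodule.restrictScalars_bot]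
      exact finrank_bot k R
    | succ t ih =>
      intro ht
      obtain ⟨hle, g, hg, hker⟩ := hidx t ht
      rw [finrank_eq_add_of_surjective hle g hg hker, ih (by omega), Finset.sum_range_succ]
  -- The left side is the codimension of `topKernel i`, which the layers Δ_i must fill one dimension
  -- at a time.
  have hmult : ∀ i, Nat.card {p | P.TargetMax p ∧ P.tgt p = i} ≤
      ((Finset.range m).filter fun t => idx t = i).card := by
    intro i
    have h1 : ∀ t ≤ m, finrank k ((F t).restrictScalars k ⊔ P.topKernel i : Submodule k R) ≤
        finrank k (P.topKernel i) + ∑ s ∈ Finset.range t, if idx s = i then 1 else 0 := by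
      intro t
      induction t with
      | zero =>
        intro _
        rw [hF0, Submodule.restrictScalars_bot, bot_sup_eq]
        exact Nat.le_add_right _ _
      | succ t ih =>
        intro ht
        obtain ⟨hle, g, hg, hker⟩ := hidx t ht
        refine (h.finrank_sup_topKernel_le g hg hker).trans ?_
        rw [Finset.sum_range_succ, ← add_assoc]
        exact Nat.add_le_add_right (ih (by omega)) _
    have h2 := h1 m le_rfl
    rw [hFm, Submodule.restrictScalars_top, top_sup_eq, finrank_top, topKernel, P.finrank_span,
      finrank_eq_nat_card_basis P.basis, ← Finset.card_filter] at h2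
    have h3 := Nat.card_congr (Equiv.Set.sumCompl {p | P.TargetMax p ∧ P.tgt p = i})
    rw [Nat.card_sum] at h3
    have h4 : {p | ¬ (P.TargetMax p ∧ P.tgt p = i)} = {p | P.TargetMax p ∧ P.tgt p = i}ᶜ := rfl
    rw [h4] at h2
    omega
  let Pair := {x : ι × ι // P.SourceMax x.1 ∧ P.TargetMax x.2 ∧ P.tgt x.2 = P.src x.1}
  -- Grouping pairs by the common vertex `j`, their number is at most the sum over `j` of the
  -- multiplicity of Δ_j times dim Δ_j, which is dim R.
  have hpair : Nat.card Pair ≤ Nat.card ι := by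
    let E : Pair ≃ Σ j : Fin n, {c | P.SourceMax c ∧ P.src c = j} ×
        {b | P.TargetMax b ∧ P.tgt b = j} :=
      { toFun := fun x => ⟨P.src x.1.1, ⟨x.1.1, x.2.1, rfl⟩, ⟨x.1.2, x.2.2.1, x.2.2.2⟩⟩
        invFun := fun y => ⟨(y.2.1.1, y.2.2.1), y.2.1.2.1, y.2.2.2.1,
          y.2.2.2.2.trans y.2.1.2.2.symm⟩
        left_inv := fun _ => rfl
        right_inv := by
          rintro ⟨j, ⟨c, hc, rfl⟩, ⟨b, hb, hbj⟩⟩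
          rfl }
    rw [Nat.card_congr E, Nat.card_sigma]
    have h1 := hdim m le_rfl
    rw [hFm, Submodule.restrictScalars_top, finrank_top, finrank_eq_nat_card_basis P.basis] at h1
    rw [h1, ← Finset.sum_fiberwise (Finset.range m) idx]
    refine Finset.sum_le_sum fun j _ => ?_
    rw [Nat.card_prod, mul_comm]
    refine (Nat.mul_le_mul (hmult j) (P.card_le_finrank_standard j)).trans (le_of_eq ?_)
    rw [Finset.sum_congr rfl (g := fun _ => finrank k (standard R e j)), Finset.sum_const,
      smul_eq_mul]
    intro t ht
    rw [(Finset.mem_filter.1 ht).2]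
  choose fc fb hfc hfb hf using P.exists_factorization
  let f : ι → Pair := fun p => ⟨(fc p, fb p), hfc p, hfb p, tgt_eq_src_of_mul_eq (hf p)⟩
  have hinj : Function.Injective f := by
    intro p q hpq
    have h1 : fc p = fc q := congrArg (fun x : Pair => x.1.1) hpq
    have h2 : fb p = fb q := congrArg (fun x : Pair => x.1.2) hpq
    exact P.basis.injective (by rw [← hf p, ← hf q, h1, h2])
  -- By the count the injection `f` is onto, so the given pair is the factorization of an actual
  -- path.
  obtain ⟨p, hp⟩ := (hinj.bijective_of_nat_card_le hpair).2 ⟨(c, b), hc, hb, hcb⟩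
  have h1 : fc p = c := congrArg (fun x : Pair => x.1.1) hp
  have h2 : fb p = b := congrArg (fun x : Pair => x.1.2) hp
  rw [← h1, ← h2, hf]
  exact P.basis.ne_zero p

end PathBasis

namespace PathBasis

open Module

variable {k : Type*} [Field k] {R : Type u} [Ring R] [Algebra k R] {n : ℕ} {e : Fin n → R}
  {ι : Type*} (P : PathBasis k e ι)

/-! ### Subalgebras spanned by paths -/

/-- The subalgebra spanned by a set of paths that contains the trivial ones and is closed under
products. -/
def subalgebra (T : Set ι) (h1 : ∀ i, P.triv i ∈ T)
    (hmul : ∀ p ∈ T, ∀ q ∈ T, ∀ r, P.basis p * P.basis q = P.basis r → r ∈ T) :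
    Subalgebra k R where
  carrier := P.span T
  mul_mem' := mul_mem_span hmul
  add_mem' := Submodule.add_mem _
  algebraMap_mem' c := by
    rw [Algebra.algebraMap_eq_smul_one, ← P.sum_idem]
    exact Submodule.smul_mem _ _ (Submodule.sum_mem _ fun i _ => idem_mem_span.2 (h1 i))

theorem sourceMax_triv (i : Fin n) : P.SourceMax (P.triv i) := fun t ht => by
  rw [P.len_triv, Nat.le_zero] at ht
  rw [ht]
  exact le_rfl

theorem targetMax_triv (i : Fin n) : P.TargetMax (P.triv i) :=
  P.op_sourceMax.1 (P.op.sourceMax_triv i)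

variable {P}

theorem SourceMax.tgt_le {p : ι} (hp : P.SourceMax p) : P.tgt p ≤ P.src p := hp _ le_rfl

theorem TargetMax.src_le {p : ι} (hp : P.TargetMax p) : P.src p ≤ P.tgt p := hp _ (Nat.zero_le _)

theorem TargetMax.mul {p q r : ι} (hp : P.TargetMax p) (hq : P.TargetMax q)
    (h : P.basis p * P.basis q = P.basis r) : P.TargetMax r := by
  intro t ht
  rw [tgt_of_mul_eq h]
  rcases vert_mem_of_mul_eq h ht with ⟨s, hs, hts⟩ | ⟨s, hs, hts⟩
  · rw [hts]
    refine (hq s hs).trans ?_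
    rw [tgt_eq_src_of_mul_eq h]
    exact hp.src_le
  · rw [hts]
    exact hp s hs

/-- A path that passes through a vertex larger than its source factors at the first of those. -/
theorem exists_first_exit {p : ι} (hp : ¬ P.SourceMax p) :
    ∃ q r, P.basis q * P.basis r = P.basis p ∧ P.src r < P.tgt r ∧
      ∀ t < P.len r, P.vert r t ≤ P.src r := by
  classical
  rw [SourceMax] at hp
  push Not at hp
  obtain ⟨ht, hlt⟩ := Nat.find_spec hp
  obtain ⟨q, r, h, hr⟩ := P.split p _ ht
  refine ⟨q, r, h, ?_, fun s hs => ?_⟩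
  · rwa [tgt, ← vert_of_mul_eq h le_rfl, ← src_of_mul_eq h, hr]
  · rw [← vert_of_mul_eq h hs.le, ← src_of_mul_eq h]
    by_contra hs'
    have hl := len_of_mul_eq h
    exact Nat.find_min hp (hr ▸ hs) ⟨by omega, not_le.1 hs'⟩

theorem targetMax_of_first_exit {r : ι} (h : P.src r < P.tgt r)
    (hr : ∀ t < P.len r, P.vert r t ≤ P.src r) : P.TargetMax r := by
  intro t ht
  rcases ht.lt_or_eq with ht | rfl
  · exact (hr t ht).trans h.le
  · exact le_rfl

theorem len_pos_of_src_lt_tgt {p : ι} (h : P.src p < P.tgt p) : 0 < P.len p := by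
  rw [Nat.pos_iff_ne_zero]
  intro h0
  rw [tgt, h0] at h
  exact lt_irrefl _ h

variable (P)

/-! ### The subalgebra generated by the right-minimal direction-preserving paths -/

theorem isDirectionPreserving_iff {p : ι} :
    IsDirectionPreserving e (P.basis p) ↔ P.src p < P.tgt p := by
  constructor
  · rintro ⟨i, j, hij, h⟩
    have hi : P.src p = i := by
      by_contra hi
      rw [mul_assoc, P.basis_mul_idem_of_ne hi, mul_zero] at h
      exact P.basis.ne_zero p h.symm
    have hj : P.tgt p = j := by
      by_contra hj
      rw [P.idem_mul_basis_of_ne hj, zero_mul] at h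
      exact P.basis.ne_zero p h.symm
    rwa [hi, hj]
  · exact fun h => ⟨_, _, h, by rw [P.idem_mul_basis, P.basis_mul_idem]⟩

/-- Along a product the inequality source ≤ target persists, and it is strict as soon as one factor
is direction-preserving. -/
theorem mem_maxSubalgebra_iff {x : R} :
    x ∈ maxSubalgebra k e (Set.range P.basis) ↔
      x ∈ P.span {p | P.len p = 0 ∨ P.src p < P.tgt p} := by
  constructor
  · have h1 : ∀ i, P.triv i ∈ {p | P.len p = 0 ∨ P.src p < P.tgt p} :=
      fun i => Or.inl (P.len_triv i)
    have hmul : ∀ p ∈ {p | P.len p = 0 ∨ P.src p < P.tgt p},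
        ∀ q ∈ {p | P.len p = 0 ∨ P.src p < P.tgt p}, ∀ r,
        P.basis p * P.basis q = P.basis r → r ∈ {p | P.len p = 0 ∨ P.src p < P.tgt p} := by
      intro p hp q hq r h
      have hle : ∀ p, (P.len p = 0 ∨ P.src p < P.tgt p) → P.src p ≤ P.tgt p := by
        rintro p (hp | hp)
        · rw [tgt, hp]
          exact le_rfl
        · exact hp.le
      have hs := tgt_eq_src_of_mul_eq h
      simp only [Set.mem_ofPred_eq] at hp hq ⊢
      rw [src_of_mul_eq h, tgt_of_mul_eq h, len_of_mul_eq h]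
      rcases id hp with hp' | hp'
      · rcases id hq with hq' | hq'
        · exact Or.inl (by omega)
        · exact Or.inr (hq'.trans_le (hs.le.trans (hle p hp)))
      · exact Or.inr ((hle q hq).trans_lt (hs.le.trans_lt hp'))
    suffices h : maxSubalgebra k e (Set.range P.basis) ≤ P.subalgebra _ h1 hmul from fun hx => h hx
    refine Algebra.adjoin_le (Set.union_subset ?_ ?_)
    · refine (Submodule.span_le (p := P.span _)).2 ?_
      rintro _ ⟨i, rfl⟩
      exact idem_mem_span.2 (h1 i)
    · rintro _ ⟨⟨p, rfl⟩, hp⟩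
      exact basis_mem_span.2 (Or.inr (P.isDirectionPreserving_iff.1 hp))
  · refine fun hx => (span_le (U := Subalgebra.toSubmodule
      (maxSubalgebra k e (Set.range P.basis)))).2 (fun p hp => ?_) hx
    rcases hp with hp | hp
    · rw [P.eq_triv_src hp, P.basis_triv]
      exact Algebra.subset_adjoin (Or.inl (Submodule.subset_span ⟨_, rfl⟩))
    · exact Algebra.subset_adjoin (Or.inr ⟨⟨p, rfl⟩, P.isDirectionPreserving_iff.2 hp⟩)

theorem mem_jacobson_subalgebra_iff [Finite ι] (B : Subalgebra k R) (hB : ∀ i, e i ∈ B) {x : B} :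
    x ∈ Ring.jacobson B ↔ (x : R) ∈ P.span {p | 0 < P.len p} := by
  rw [(P.isSplitBasic_subalgebra B hB).mem_jacobson, ← char_eq_zero_iff]
  rfl

/-- Both radicals are spanned by paths: that of `R` by the nontrivial ones, that of B_max by the
direction-preserving ones. Their product is then spanned by products of such paths. -/
theorem basis_mem_radMulRad_iff [Finite ι] {r : ι} :
    P.basis r ∈ radMulRad k (maxSubalgebra k e (Set.range P.basis)) ↔
      ∃ q s, P.basis q * P.basis s = P.basis r ∧ 0 < P.len q ∧ P.src s < P.tgt s := by
  have hidem : ∀ i, e i ∈ maxSubalgebra k e (Set.range P.basis) := fun i =>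
    P.mem_maxSubalgebra_iff.2 (idem_mem_span.2 (Or.inl (P.len_triv i)))
  have hR : ∀ x, x ∈ Ring.jacobson R ↔ x ∈ P.span {p | 0 < P.len p} := fun x => by
    rw [P.isSplitBasic.mem_jacobson, char_eq_zero_iff]
  have hB : ∀ x : maxSubalgebra k e (Set.range P.basis), x ∈ Ring.jacobson _ ↔
      (x : R) ∈ P.span {p | P.src p < P.tgt p} := fun x => by
    rw [P.mem_jacobson_subalgebra_iff _ hidem]
    have hx := mem_span.1 (P.mem_maxSubalgebra_iff.1 x.2)
    refine ⟨fun h => mem_span.2 fun p hp => ?_, fun h => span_mono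
      (fun p hp => len_pos_of_src_lt_tgt hp) h⟩
    exact (hx p hp).resolve_left (Nat.pos_iff_ne_zero.1 (mem_span.1 h p hp))
  constructor
  · intro h
    have hle : radMulRad k (maxSubalgebra k e (Set.range P.basis)) ≤ P.span
        {r | ∃ q s, P.basis q * P.basis s = P.basis r ∧ 0 < P.len q ∧ P.src s < P.tgt s} := by
      refine Submodule.span_le.2 ?_
      rintro _ ⟨a, ha, b, hb, rfl⟩
      have ha' := (hR a).1 ha
      have hb' := (hB b).1 hb
      refine mul_mem_span ?_ ha' hb'
      intro q hq s hs r h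
      exact ⟨q, s, h, hq, hs⟩
    have := hle h
    rwa [basis_mem_span] at this
  · rintro ⟨q, s, h, hq, hs⟩
    have hsB : P.basis s ∈ maxSubalgebra k e (Set.range P.basis) :=
      P.mem_maxSubalgebra_iff.2 (basis_mem_span.2 (Or.inr hs))
    have hq' : P.basis q ∈ Ring.jacobson R := (hR _).2 (basis_mem_span.2 hq)
    have hs' : (⟨P.basis s, hsB⟩ : maxSubalgebra k e (Set.range P.basis)) ∈ Ring.jacobson _ :=
      (hB ⟨_, hsB⟩).2 (basis_mem_span.2 hs)
    exact Submodule.subset_span ⟨P.basis q, hq', ⟨P.basis s, hsB⟩, hs', h.symm⟩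

theorem isRightMinimal_iff [Finite ι] {r : ι} :
    IsRightMinimal k e (Set.range P.basis) (P.basis r) ↔
      (P.len r = 0 ∨ P.src r < P.tgt r) ∧
        ¬ ∃ q s, P.basis q * P.basis s = P.basis r ∧ 0 < P.len q ∧ P.src s < P.tgt s := by
  rw [IsRightMinimal, P.mem_maxSubalgebra_iff, basis_mem_span, P.basis_mem_radMulRad_iff]
  rfl

variable {P} in
/-- The right-minimal direction-preserving paths generate the span of the paths whose target is
their largest vertex. -/
theorem NoReturn.mem_minSubalgebra_iff [Finite ι] (h : P.NoReturn) {x : R} :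
    x ∈ minSubalgebra k e (Set.range P.basis) ↔ x ∈ P.span {p | P.TargetMax p} := by
  constructor
  · suffices hle : minSubalgebra k e (Set.range P.basis) ≤
        P.subalgebra {p | P.TargetMax p} P.targetMax_triv
          (fun p hp q hq r hr => TargetMax.mul hp hq hr) from fun hx => hle hx
    refine Algebra.adjoin_le ?_
    rintro _ ⟨⟨p, rfl⟩, hp⟩
    rw [P.isRightMinimal_iff] at hp
    obtain ⟨h1, h2⟩ := hp
    refine basis_mem_span.2 ?_
    rcases h1 with h1 | h1
    · rw [P.eq_triv_src h1]
      exact P.targetMax_triv _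
    · intro t ht
      by_contra hlt
      rw [not_le] at hlt
      -- Cut at a vertex above the target: `s` is direction-preserving and `q` is nontrivial,
      -- against right-minimality.
      obtain ⟨q, s, hqs, hs⟩ := P.split p t ht
      have hl := len_of_mul_eq hqs
      refine h2 ⟨q, s, hqs, ?_, ?_⟩
      · rw [Nat.pos_iff_ne_zero]
        intro h0
        rw [tgt, hl, h0, hs, add_zero] at hlt
        exact lt_irrefl _ hlt
      · rw [tgt, ← vert_of_mul_eq hqs le_rfl, hs, ← src_of_mul_eq hqs]
        exact h1.trans hlt
  · refine fun hx => (span_le (U := Subalgebra.toSubmodule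
      (minSubalgebra k e (Set.range P.basis)))).2 ?_ hx
    suffices H : ∀ (m : ℕ) (p : ι), P.len p = m → P.TargetMax p →
        P.basis p ∈ minSubalgebra k e (Set.range P.basis) from fun p hp => H _ p rfl hp
    intro m
    induction m using Nat.strong_induction_on with
    | _ m ih =>
      intro p hm hp
      rcases Nat.eq_zero_or_pos (P.len p) with h0 | h0
      · refine Algebra.subset_adjoin ⟨⟨p, rfl⟩, P.isRightMinimal_iff.2 ⟨Or.inl h0, ?_⟩⟩
        rintro ⟨q, s, hqs, hq, -⟩
        have := len_of_mul_eq hqs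
        omega
      -- A path that is both `SourceMax` and `TargetMax` is closed, hence trivial by `NoReturn`. So
      -- a first vertex above the source exists; the piece up to it is right-minimal and the shorter
      -- rest is still `TargetMax`.
      · have hns : ¬ P.SourceMax p := fun hs =>
          h0.ne' (h p hs (le_antisymm hs.tgt_le hp.src_le))
        obtain ⟨q, r, hqr, hr, hr'⟩ := exists_first_exit hns
        have hl := len_of_mul_eq hqr
        have hl' := len_pos_of_src_lt_tgt hr
        rw [← hqr]
        refine mul_mem (ih (P.len q) (by omega) q rfl fun t ht => ?_) (Algebra.subset_adjoin
          ⟨⟨r, rfl⟩, P.isRightMinimal_iff.2 ⟨Or.inr hr, ?_⟩⟩)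
        · rw [← vert_add_of_mul_eq hqr ht, ← tgt_of_mul_eq hqr]
          exact hp _ (by omega)
        -- A proper initial piece of `r` ends no higher than the source of `r`, so it is not
        -- direction-preserving.
        · rintro ⟨a, s, has, ha, hs⟩
          have := hr' (P.len s) (by rw [len_of_mul_eq has]; omega)
          rw [vert_of_mul_eq has le_rfl, src_of_mul_eq has] at this
          exact absurd this (not_le.2 hs)

/-! ### Unique factorization at the largest vertex -/

variable {P} in
-- Between two visits to a largest vertex the path would run through a nontrivial closed `SourceMax`
-- path.
theorem NoReturn.vert_lt (h : P.NoReturn) {p : ι} {s t : ℕ} (hst : s < t) (ht : t ≤ P.len p)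
    (hmax : ∀ u ≤ P.len p, P.vert p u ≤ P.vert p s) : P.vert p t < P.vert p s := by
  refine (hmax t ht).lt_of_ne fun heq => ?_
  obtain ⟨q, r, hqr, hr⟩ := P.split p t ht
  obtain ⟨a, b, hab, hb⟩ := P.split r s (by omega)
  have hl := len_of_mul_eq hab
  have hl' := len_of_mul_eq hqr
  have hv : ∀ u ≤ P.len a, P.vert a u = P.vert p (s + u) := fun u hu => by
    rw [← vert_add_of_mul_eq hab hu, hb, vert_of_mul_eq hqr (by omega)]
  have h1 : P.src a = P.vert p s := hv 0 (Nat.zero_le _)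
  have h2 : P.tgt a = P.vert p s := by
    rw [tgt, hv _ le_rfl, ← heq]
    congr 1
    omega
  have := h a (fun u hu => by rw [h1, hv u hu]; exact hmax _ (by omega)) (h2.trans h1.symm)
  omega

variable {P} in
-- Either factorization cuts `p` at a largest vertex. By `vert_lt` this determines the position of
-- the cut, and `cancel` does the rest.
theorem NoReturn.factorization_unique (h : P.NoReturn) {c b c' b' p : ι} (hc : P.SourceMax c)
    (hb : P.TargetMax b) (hc' : P.SourceMax c') (hb' : P.TargetMax b')
    (hp : P.basis c * P.basis b = P.basis p) (hp' : P.basis c' * P.basis b' = P.basis p) :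
    c = c' ∧ b = b' := by
  have key : ∀ c b, P.SourceMax c → P.TargetMax b → P.basis c * P.basis b = P.basis p →
      P.len b ≤ P.len p ∧ ∀ u ≤ P.len p, P.vert p u ≤ P.vert p (P.len b) := by
    intro c b hc hb hp
    refine ⟨by rw [len_of_mul_eq hp]; omega, fun u hu => ?_⟩
    rw [vert_of_mul_eq hp le_rfl]
    rcases vert_mem_of_mul_eq hp hu with ⟨s, hs, hus⟩ | ⟨s, hs, hus⟩
    · rw [hus]
      exact hb s hs
    · rw [hus]
      refine (hc s hs).trans ?_
      rw [← tgt_eq_src_of_mul_eq hp]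
      exact le_rfl
  obtain ⟨h1, h2⟩ := key c b hc hb hp
  obtain ⟨h1', h2'⟩ := key c' b' hc' hb' hp'
  refine P.cancel _ _ _ _ (hp.trans hp'.symm) (hp ▸ P.basis.ne_zero p) ?_
  rcases lt_trichotomy (P.len b) (P.len b') with hlt | heq | hlt
  · exact absurd (h2' _ h1) (not_le.2 (h.vert_lt hlt h1' h2))
  · exact heq
  · exact absurd (h2 _ h1') (not_le.2 (h.vert_lt hlt h1 h2'))

variable {P} in
-- For a closed path the source and target conditions coincide, so the property is symmetric.
theorem NoReturn.op (h : P.NoReturn) : P.op.NoReturn := by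
  intro p hp ht
  rw [op_src, op_tgt] at ht
  rw [op_sourceMax] at hp
  rw [op_len]
  by_contra h0
  have := h.vert_lt (p := p) (s := 0) (Nat.pos_of_ne_zero h0) le_rfl
    (fun u hu => (hp u hu).trans_eq ht.symm)
  exact absurd ht (ne_of_gt this)

/-- The product of a path that starts at its largest vertex with a path that ends there, as its
largest vertex, is nonzero. -/
def ProductsNonzero : Prop :=
  ∀ c b, P.SourceMax c → P.TargetMax b → P.tgt b = P.src c → P.basis c * P.basis b ≠ 0

variable {P} in
theorem ProductsNonzero.op (h : P.ProductsNonzero) : P.op.ProductsNonzero := by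
  intro c b hc hb hcb h0
  rw [op_sourceMax] at hc
  rw [op_targetMax] at hb
  rw [op_src, op_tgt] at hcb
  rw [op_basis, op_basis, ← MulOpposite.op_mul, MulOpposite.op_eq_zero_iff] at h0
  exact h b c hb hc hcb.symm h0

/-- The factor of a path after its largest vertex. -/
def left (p : ι) : ι := (P.exists_factorization p).choose

/-- The factor of a path before its largest vertex. -/
def right (p : ι) : ι := (P.exists_factorization p).choose_spec.choose

theorem sourceMax_left (p : ι) : P.SourceMax (P.left p) :=
  (P.exists_factorization p).choose_spec.choose_spec.1

theorem targetMax_right (p : ι) : P.TargetMax (P.right p) :=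
  (P.exists_factorization p).choose_spec.choose_spec.2.1

theorem left_mul_right (p : ι) : P.basis (P.left p) * P.basis (P.right p) = P.basis p :=
  (P.exists_factorization p).choose_spec.choose_spec.2.2

variable {P} in
theorem NoReturn.left_right_eq (h : P.NoReturn) {c b p : ι} (hc : P.SourceMax c)
    (hb : P.TargetMax b) (hp : P.basis c * P.basis b = P.basis p) :
    P.left p = c ∧ P.right p = b :=
  h.factorization_unique (P.sourceMax_left p) (P.targetMax_right p) hc hb (P.left_mul_right p) hp

end PathBasis

/-! ### Exactness of induction -/

section InductionExact

variable {k : Type u} [Field k] {R : Type v} [Ring R] [Algebra k R] (B : Subalgebra k R)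

theorem mk_mul_tmul {M : Type w} [AddCommGroup M] [Module k M] [Module B M] (a : R) (b : B) (m : M) :
    (Submodule.Quotient.mk ((a * (b : R)) ⊗ₜ[k] m) : Induced B M) =
      Submodule.Quotient.mk (a ⊗ₜ[k] (b • m)) :=
  (Submodule.Quotient.eq _).2 (Submodule.subset_span ⟨a, b, m, rfl⟩)

variable {M N P : Type w} [AddCommGroup M] [Module k M] [Module B M] [IsScalarTower k B M]
  [AddCommGroup N] [Module k N] [Module B N] [IsScalarTower k B N]
  [AddCommGroup P] [Module k P] [Module B P] [IsScalarTower k B P]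

theorem inducedMap_mk (f : M →ₗ[B] N) (z : R ⊗[k] M) :
    inducedMap B f (Submodule.Quotient.mk z) =
      Submodule.Quotient.mk (LinearMap.lTensor R (f.restrictScalars k) z) := rfl

theorem inducedMap_surjective (g : N →ₗ[B] P) (hg : Function.Surjective g) :
    Function.Surjective (inducedMap B g) := by
  intro x
  obtain ⟨z, rfl⟩ := Submodule.Quotient.mk_surjective _ x
  obtain ⟨y, rfl⟩ := LinearMap.lTensor_surjective R (g := g.restrictScalars k) hg z
  exact ⟨Submodule.Quotient.mk y, rfl⟩

theorem exists_lTensor_eq_of_mem_inducedRel (g : N →ₗ[B] P) (hg : Function.Surjective g)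
    {z : R ⊗[k] P} (hz : z ∈ inducedRel B P) :
    ∃ y ∈ inducedRel B N, LinearMap.lTensor R (g.restrictScalars k) y = z := by
  suffices h : inducedRel B P ≤ (inducedRel B N).map
      (TensorProduct.AlgebraTensorModule.lTensor R R (g.restrictScalars k)) from h hz
  refine Submodule.span_le.2 ?_
  rintro _ ⟨a, b, p, rfl⟩
  obtain ⟨m, rfl⟩ := hg p
  exact ⟨_, Submodule.subset_span ⟨a, b, m, rfl⟩, by simp⟩

/-- Relations lift along the surjection `g`; after subtracting such a lift, exactness of `R ⊗_k -`
applies. Nothing is required of `B` here. -/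
theorem inducedMap_exact (f : M →ₗ[B] N) (g : N →ₗ[B] P) (hfg : Function.Exact f g)
    (hg : Function.Surjective g) : Function.Exact (inducedMap B f) (inducedMap B g) := by
  have h := lTensor_exact R (f := f.restrictScalars k) (g := g.restrictScalars k) hfg hg
  intro x
  obtain ⟨z, rfl⟩ := Submodule.Quotient.mk_surjective _ x
  constructor
  · intro hx
    rw [inducedMap_mk, Submodule.Quotient.mk_eq_zero] at hx
    obtain ⟨y, hy, hyz⟩ := exists_lTensor_eq_of_mem_inducedRel B g hg hx
    obtain ⟨m, hm⟩ := (h (z - y)).1 (by rw [map_sub, hyz, sub_self])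
    refine ⟨Submodule.Quotient.mk m, ?_⟩
    rw [inducedMap_mk, hm, Submodule.Quotient.eq, sub_sub_cancel_left]
    exact Submodule.neg_mem _ hy
  · rintro ⟨y, hy⟩
    obtain ⟨m, rfl⟩ := Submodule.Quotient.mk_surjective _ y
    rw [inducedMap_mk] at hy
    rw [← hy, inducedMap_mk, h.apply_apply_eq_zero]
    rfl

/-- If `R` has a dual basis as a right `B`-module, induction preserves injections. -/
theorem inducedMap_injective {κ : Type*} [Fintype κ] (c : κ → R) (β : κ → R →ₗ[k] B)
    (hβ : ∀ x a (b : B), β x (a * (b : R)) = β x a * b) (hc : ∀ a, ∑ x, c x * (β x a : R) = a)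
    (f : M →ₗ[B] N) (hf : Function.Injective f) : Function.Injective (inducedMap B f) := by
  let ψM : κ → R ⊗[k] M →ₗ[k] M := fun x =>
    TensorProduct.lift ((Algebra.lsmul k k M).toLinearMap.comp (β x))
  let ψN : κ → R ⊗[k] N →ₗ[k] N := fun x =>
    TensorProduct.lift ((Algebra.lsmul k k N).toLinearMap.comp (β x))
  have hM : ∀ x a m, ψM x (a ⊗ₜ m) = β x a • m := fun x a m => rfl
  have hN : ∀ x a m, ψN x (a ⊗ₜ m) = β x a • m := fun x a m => rfl
  -- The relations form an `R`-span while `ψN x` is only `k`-linear, so the induction carries a left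
  -- factor `r`.
  have hrel : ∀ z ∈ inducedRel B N, ∀ (r : R) x, ψN x (r • z) = 0 := by
    intro z hz
    induction hz using Submodule.span_induction with
    | mem z hz =>
      obtain ⟨a, b, m, rfl⟩ := hz
      intro r x
      rw [smul_sub, TensorProduct.smul_tmul', TensorProduct.smul_tmul', map_sub, hN, hN,
        smul_eq_mul, smul_eq_mul, ← mul_assoc, hβ, mul_smul, sub_self]
    | zero => intro r x; rw [smul_zero, map_zero]
    | add y z _ _ hy hz => intro r x; rw [smul_add, map_add, hy, hz, add_zero]
    | smul a z _ hz => intro r x; rw [smul_smul, hz]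
  -- The dual basis recovers a class from its coordinates `ψM x z`, so vanishing coordinates force a
  -- zero class.
  have hmk : ∀ z : R ⊗[k] M, (Submodule.Quotient.mk z : Induced B M) =
      ∑ x, Submodule.Quotient.mk (c x ⊗ₜ ψM x z) := by
    intro z
    induction z using TensorProduct.induction_on with
    | zero => simp
    | tmul a m =>
      simp only [hM, ← mk_mul_tmul]
      conv_lhs => rw [← hc a]
      rw [TensorProduct.sum_tmul]
      exact map_sum (inducedRel B M).mkQ _ _
    | add y z hy hz =>
      rw [Submodule.Quotient.mk_add, hy, hz, ← Finset.sum_add_distrib]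
      refine Finset.sum_congr rfl fun x _ => ?_
      rw [map_add, TensorProduct.tmul_add, Submodule.Quotient.mk_add]
  have hnat : ∀ x z, ψN x (LinearMap.lTensor R (f.restrictScalars k) z) = f (ψM x z) := by
    intro x z
    induction z using TensorProduct.induction_on with
    | zero => simp
    | tmul a m =>
      rw [LinearMap.lTensor_tmul, hM, hN, map_smul]
      rfl
    | add y z hy hz => simp only [map_add, hy, hz]
  rw [← LinearMap.ker_eq_bot, LinearMap.ker_eq_bot']
  intro y hy
  obtain ⟨z, rfl⟩ := Submodule.Quotient.mk_surjective _ y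
  rw [inducedMap_mk, Submodule.Quotient.mk_eq_zero] at hy
  rw [hmk]
  refine Finset.sum_eq_zero fun x _ => ?_
  have h1 := hrel _ hy 1 x
  rw [one_smul, hnat] at h1
  rw [(map_eq_zero_iff f hf).1 h1, TensorProduct.tmul_zero, Submodule.Quotient.mk_zero]

end InductionExact

namespace PathBasis

open Module

variable {k : Type v} [Field k] {R : Type u} [Ring R] [Algebra k R] {n : ℕ} {e : Fin n → R}
  {ι : Type*} {P : PathBasis k e ι}

/-! ### The exact Borel subalgebra -/

section Borel

variable {B : Subalgebra k R} (hB : ∀ x, x ∈ B ↔ x ∈ P.span {p | P.TargetMax p})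
include hB

theorem idem_mem_of_targetMax (i : Fin n) : e i ∈ B :=
  (hB _).2 (idem_mem_span.2 (P.targetMax_triv i))

open Classical in
/-- The coefficient in `B`, on the right of the path `c`, of an element of `R`. -/
def rightCoeff (c : ι) : R →ₗ[k] B :=
  P.basis.constr k fun p => if P.left p = c then
    (⟨P.basis (P.right p), (hB _).2 (basis_mem_span.2 (P.targetMax_right p))⟩ : B) else 0

open Classical in
theorem rightCoeff_basis (c p : ι) : (rightCoeff hB c (P.basis p) : R) =
    if P.left p = c then P.basis (P.right p) else 0 := by
  rw [rightCoeff, Basis.constr_basis]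
  split_ifs <;> rfl

/-- Let `p = c b` be factored and `q` be `TargetMax`. If `b q` is a path, it is `TargetMax`, so `c
(b q)` is nonzero and is the factorization of `p q`: multiplication by `q` leaves the left factor
unchanged. -/
theorem rightCoeff_mul (h : P.NoReturn) (h' : P.ProductsNonzero) (c : ι) (a : R) (b : B) :
    rightCoeff hB c (a * (b : R)) = rightCoeff hB c a * b := by
  classical
  refine Subtype.ext ?_
  rw [Subalgebra.coe_mul]
  have hb := (hB b).1 b.2
  refine sub_eq_zero.1 (?_ : _ ∈ (⊥ : Submodule k R))
  let D : R →ₗ[k] R →ₗ[k] R :=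
    (LinearMap.mul k R).compr₂ (B.val.toLinearMap.comp (rightCoeff hB c)) -
      (LinearMap.mul k R).comp (B.val.toLinearMap.comp (rightCoeff hB c))
  have hD : P.span {p | P.TargetMax p} ≤ LinearMap.ker (D a) := by
    refine span_le.2 fun q hq => ?_
    have : D.flip (P.basis q) = 0 := by
      refine P.basis.ext fun p => ?_
      change (rightCoeff hB c (P.basis p * P.basis q) : R) -
        (rightCoeff hB c (P.basis p) : R) * P.basis q = 0
      rw [rightCoeff_basis]
      rcases mul_cases (P := P) (P.right p) q with h0 | ⟨r, hr⟩
      · rw [← P.left_mul_right p, mul_assoc, h0, mul_zero, map_zero]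
        split_ifs <;> simp [h0]
      · have hrm := TargetMax.mul (P.targetMax_right p) hq hr
        have hne := h' (P.left p) r (P.sourceMax_left p) hrm
          ((tgt_of_mul_eq hr).trans (tgt_eq_src_of_mul_eq (P.left_mul_right p)))
        obtain ⟨s, hs⟩ := (mul_cases _ _).resolve_left hne
        obtain ⟨h1, h2⟩ := h.left_right_eq (P.sourceMax_left p) hrm hs
        have hps : P.basis p * P.basis q = P.basis s := by
          rw [← hs, ← hr, ← mul_assoc, P.left_mul_right]
        rw [hps, rightCoeff_basis, h1, h2]
        split_ifs
        · rw [hr, sub_self]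
        · rw [zero_mul, sub_self]
    exact LinearMap.congr_fun this a
  exact hD hb

theorem sum_mul_rightCoeff [Fintype ι] (a : R) :
    ∑ c, P.basis c * (rightCoeff hB c a : R) = a := by
  classical
  have h : ∑ c, (LinearMap.mulLeft k (P.basis c)).comp
      (B.val.toLinearMap.comp (rightCoeff hB c)) = LinearMap.id := by
    refine P.basis.ext fun p => ?_
    rw [LinearMap.sum_apply, Finset.sum_eq_single (P.left p)]
    · change P.basis (P.left p) * (rightCoeff hB (P.left p) (P.basis p) : R) = _
      rw [rightCoeff_basis, if_pos rfl, P.left_mul_right, LinearMap.id_apply]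
    · intro c _ hc
      change P.basis c * (rightCoeff hB c (P.basis p) : R) = _
      rw [rightCoeff_basis, if_neg hc.symm, mul_zero]
    · simp
  have := LinearMap.congr_fun h a
  rwa [LinearMap.sum_apply] at this

theorem nonempty_induced_equiv_standard [Finite ι] (h : P.NoReturn) {i : Fin n} {S : Type w}
    [AddCommGroup S] [Module k S] [Module B S] [IsScalarTower k B S]
    (hS : IsCharModule ((P.char i).comp B.val) S) :
    Nonempty (Induced B S ≃ₗ[R] standard R e i) := by
  obtain ⟨s, hs0, -⟩ := id hS
  have hsmul : ∀ (b : B) (y : S), b • y = P.char i b • y := fun b y => by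
    rw [hS.smul_eq, algebraMap_smul]
    rfl
  let E : k ≃ₗ[k] S := LinearEquiv.ofBijective (LinearMap.toSpanSingleton k S s)
    ⟨smul_left_injective k hs0, fun y => by
      obtain ⟨c, rfl⟩ := hS.exists_smul (y := y) hs0
      exact ⟨c, by rw [algebraMap_smul]; rfl⟩⟩
  let ℓ : S →ₗ[k] k := E.symm.toLinearMap
  have hℓ : ∀ y, ℓ y • s = y := fun y => E.apply_symm_apply y
  have hℓs : ℓ s = 1 := by
    refine (E.symm_apply_eq).2 ?_
    exact (one_smul k s).symm
  let ei : proj R e i := ⟨e i, Submodule.mem_span_singleton_self _⟩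
  let δ : standard R e i := Submodule.Quotient.mk ei
  -- A `TargetMax` path from `i` that survives in Δ_i is also `SourceMax`, hence closed, hence
  -- trivial.
  have hδ : ∀ b : B, (b : R) • δ = P.char i (b : R) • δ := by
    intro b
    rw [← algebraMap_smul R (P.char i (b : R)) δ, ← sub_eq_zero, ← sub_smul]
    change Submodule.Quotient.mk (((b : R) - algebraMap k R (P.char i b)) • ei) = 0
    rw [Submodule.Quotient.mk_eq_zero, P.mem_standardKernel_iff, mem_span]
    intro p hp hm
    change P.basis.repr (((b : R) - algebraMap k R (P.char i b)) * e i) p ≠ 0 at hp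
    have h1 : P.TargetMax p ∧ P.src p = i ∨ p = P.triv i := by
      by_contra hcon
      rw [not_or] at hcon
      apply hp
      have h2 : P.basis.repr ((b : R) * e i) p = 0 := by
        by_contra h3
        exact hcon.1 (mem_span.1 (mul_idem_mem ((hB b).1 b.2) i) p h3)
      rw [sub_mul, map_sub, Finsupp.sub_apply, h2, ← Algebra.smul_def, map_smul, ← P.basis_triv,
        Basis.repr_self, Finsupp.smul_apply, Finsupp.single_eq_of_ne hcon.2, smul_zero, sub_zero]
    have h2 : p = P.triv i := by
      rcases h1 with ⟨hp1, hp2⟩ | h1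
      · rw [← hp2]
        exact P.eq_triv_src (h p hm (le_antisymm hm.tgt_le hp1.src_le))
      · exact h1
    apply hp
    rw [h2, ← char_apply, map_mul, map_sub, AlgHom.commutes]
    simp
  let Φ₀ : R ⊗[k] S →ₗ[R] standard R e i := TensorProduct.AlgebraTensorModule.lift
    (LinearMap.toSpanSingleton R (S →ₗ[k] standard R e i) (ℓ.smulRight δ))
  have hΦ₀ : ∀ a y, Φ₀ (a ⊗ₜ[k] y) = a • ℓ y • δ := fun a y => rfl
  let Φ : Induced B S →ₗ[R] standard R e i := (inducedRel B S).liftQ Φ₀ (by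
    refine Submodule.span_le.2 ?_
    rintro _ ⟨a, b, y, rfl⟩
    rw [SetLike.mem_coe, LinearMap.mem_ker, map_sub, hΦ₀, hΦ₀, hsmul, map_smul, mul_smul,
      smul_assoc, ← smul_comm (ℓ y) (b : R) δ, hδ, smul_comm (ℓ y), sub_self])
  let Ψ₀ : proj R e i →ₗ[R] Induced B S :=
    (LinearMap.toSpanSingleton R (Induced B S) (Submodule.Quotient.mk ((1 : R) ⊗ₜ[k] s))).comp
      (proj R e i).subtype
  have hΨ₀ : ∀ x : proj R e i, Ψ₀ x = Submodule.Quotient.mk ((x : R) ⊗ₜ[k] s) := fun x => by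
    change (x : R) • (Submodule.Quotient.mk ((1 : R) ⊗ₜ[k] s) : Induced B S) = _
    rw [← Submodule.Quotient.mk_smul, TensorProduct.smul_tmul', smul_eq_mul, mul_one]
  let Ψ : standard R e i →ₗ[R] Induced B S := (standardKernel R e i).liftQ Ψ₀ (by
    intro x hx
    rw [P.mem_standardKernel_iff] at hx
    have hx' : (x : R) ∈ P.span {p | P.src p = i ∧ ¬ P.SourceMax p} := by
      have h1 := P.mem_proj_iff.1 x.2
      rw [mem_span] at hx h1 ⊢
      exact fun p hp => ⟨h1 p hp, hx p hp⟩
    rw [LinearMap.mem_ker, hΨ₀]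
    let Θ : R →ₗ[k] Induced B S := ((inducedRel B S).mkQ.restrictScalars k).comp
      ((TensorProduct.mk k R S).flip s)
    suffices hle : P.span {p | P.src p = i ∧ ¬ P.SourceMax p} ≤ LinearMap.ker Θ from hle hx'
    refine span_le.2 ?_
    rintro p ⟨-, hp⟩
    -- The initial piece `r` up to the first exit lies in the radical of `B`, so `q r ⊗ s = q ⊗ r s
    -- = 0`.
    obtain ⟨q, r, hqr, hr, hr'⟩ := exists_first_exit hp
    have hrB : P.basis r ∈ B := (hB _).2 (basis_mem_span.2 (targetMax_of_first_exit hr hr'))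
    change Submodule.Quotient.mk (P.basis p ⊗ₜ[k] s) = 0
    rw [← hqr]
    refine (mk_mul_tmul B (P.basis q) ⟨P.basis r, hrB⟩ s).trans ?_
    rw [hsmul, P.char_eq_zero_iff.2 (basis_mem_span.2 (len_pos_of_src_lt_tgt hr)), zero_smul,
      TensorProduct.tmul_zero, Submodule.Quotient.mk_zero])
  refine ⟨LinearEquiv.ofLinearMap Φ Ψ ?_ ?_⟩
  · refine LinearMap.ext fun x => ?_
    obtain ⟨y, rfl⟩ := Submodule.Quotient.mk_surjective _ x
    change Φ (Ψ₀ y) = Submodule.Quotient.mk y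
    rw [hΨ₀]
    rw [show Φ (Submodule.Quotient.mk ((y : R) ⊗ₜ[k] s)) = Φ₀ ((y : R) ⊗ₜ[k] s) from rfl, hΦ₀, hℓs, one_smul, ← Submodule.Quotient.mk_smul]
    congr 1
    exact Subtype.ext (P.isSplitBasic.mem_proj.1 y.2)
  · refine LinearMap.ext fun x => ?_
    obtain ⟨z, rfl⟩ := Submodule.Quotient.mk_surjective _ x
    change Ψ (Φ₀ z) = Submodule.Quotient.mk z
    induction z using TensorProduct.induction_on with
    | zero => rw [map_zero, map_zero, Submodule.Quotient.mk_zero]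
    | tmul a y =>
      rw [hΦ₀, map_smul, ← algebraMap_smul R (ℓ y) δ, map_smul]
      change a • algebraMap k R (ℓ y) • Ψ₀ ei = _
      rw [hΨ₀, ← Submodule.Quotient.mk_smul, ← Submodule.Quotient.mk_smul, algebraMap_smul,
        ← TensorProduct.tmul_smul, hℓ, TensorProduct.smul_tmul', smul_eq_mul]
      refine (mk_mul_tmul B a ⟨e i, idem_mem_of_targetMax hB i⟩ y).trans ?_
      rw [hsmul]
      change Submodule.Quotient.mk (a ⊗ₜ[k] (P.char i (e i) • y)) = _
      rw [P.char_idem, if_pos rfl, one_smul]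
    | add y z hy hz => rw [map_add, map_add, hy, hz, Submodule.Quotient.mk_add]

end Borel

end PathBasis

/-! ### From spans of paths to exact Borel subalgebras, Reedy decompositions and Δ-subalgebras. -/

namespace PathBasis

open Module

variable {k : Type v} [Field k] {R : Type u} [Ring R] [Algebra k R] {n : ℕ} {e : Fin n → R}
  {ι : Type*} {P : PathBasis k e ι}

theorem idem_mul_mul_idem_eq_zero {T : Set ι} {i j : Fin n}
    (hT : ∀ p ∈ T, P.src p = i → P.tgt p ≠ j) {x : R} (hx : x ∈ P.span T) :
    e j * x * e i = 0 := by
  have h := mul_idem_mem (idem_mul_mem hx j) i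
  refine (map_eq_zero_iff P.basis.repr P.basis.repr.injective).1 (Finsupp.ext fun p => ?_)
  by_contra h0
  obtain ⟨⟨h1, h2⟩, h3⟩ := mem_span.1 h p h0
  exact hT p h1 h3 h2

/-- The simple `B`-modules are the restricted simple `R`-modules. `TargetMax` paths have source ≤
target, so e_j B e_i = 0 for `j < i`, which gives directedness. -/
theorem isExactBorel [Finite ι] (h : P.NoReturn) (h' : P.ProductsNonzero) {B : Subalgebra k R}
    (hB : ∀ x, x ∈ B ↔ x ∈ P.span {p | P.TargetMax p}) : IsExactBorel e B := by
  have := Fintype.ofFinite ι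
  have hR : ∀ i, IsCharModule (P.char i) (simple R e i) := P.isSplitBasic.isCharModule_simple
  have hS : ∀ i, IsCharModule ((P.char i).comp B.val) (simple R e i) :=
    fun i => (hR i).subalgebra B
  have hbasic := P.isSplitBasic_subalgebra B (idem_mem_of_targetMax hB)
  refine ⟨fun i => simple R e i, fun _ => inferInstance, fun _ => inferInstance,
    fun _ => inferInstance, fun _ => inferInstance, ?_⟩
  exact
    { simples := hbasic.isSimpleList hS
      exact := fun M N Q _ _ _ _ _ _ _ _ _ _ _ _ _ _ _ f g hf hfg hg =>
        ⟨inducedMap_injective B (fun c => P.basis c) (rightCoeff hB)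
          (rightCoeff_mul hB h h') (sum_mul_rightCoeff hB) f hf,
          inducedMap_exact B f g hfg hg, inducedMap_surjective B g hg⟩
      induced := fun i => nonempty_induced_equiv_standard hB h (hS i)
      endSimple := fun i => by
        obtain ⟨f⟩ := (hS i).nonempty_end_equiv
        obtain ⟨g⟩ := (hR i).nonempty_end_equiv
        exact ⟨f.trans g.symm⟩
      directed := fun i j hij => by
        by_contra hlt
        refine not_subsingleton_iff_nontrivial.2 hij (subsingleton_ext_of_idem (hS i) (hS j)
          (hbasic.idem i) (by rw [hbasic.apply, if_pos rfl]) (f := ⟨e j, _⟩)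
          (by rw [hbasic.apply, if_pos rfl]) fun b => Subtype.ext ?_)
        refine idem_mul_mul_idem_eq_zero (fun p hp hpi hpj => hlt ?_) ((hB b).1 b.2)
        rw [← hpi, ← hpj]
        exact TargetMax.src_le hp }

/-! ### The Reedy decomposition -/

/-- The inverse `θ` sends a path to the tensor of its two factors. On a composable pair `(c, b)` the
product is nonzero and its factorization is the pair itself. -/
theorem isReedyDecomposition (h : P.NoReturn) (h' : P.ProductsNonzero) {C B : Subalgebra k R}
    (hC : ∀ x, x ∈ C ↔ x ∈ P.span {p | P.SourceMax p})
    (hB : ∀ x, x ∈ B ↔ x ∈ P.span {p | P.TargetMax p}) :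
    IsReedyDecomposition (vertexSpan k e) C B := by
  have hmul : ∀ (c : C) (b : B), relTensorMul (vertexSpan k e) C B
      (Submodule.Quotient.mk (c ⊗ₜ[k] b)) = (c : R) * b := fun _ _ => rfl
  let cl : ι → C := fun p =>
    ⟨P.basis (P.left p), (hC _).2 (basis_mem_span.2 (P.sourceMax_left p))⟩
  let br : ι → B := fun p =>
    ⟨P.basis (P.right p), (hB _).2 (basis_mem_span.2 (P.targetMax_right p))⟩
  let θ : R →ₗ[k] RelTensor (vertexSpan k e) C B :=
    P.basis.constr k fun p => Submodule.Quotient.mk (cl p ⊗ₜ[k] br p)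
  have hθ : ∀ p, θ (P.basis p) = Submodule.Quotient.mk (cl p ⊗ₜ[k] br p) := fun p =>
    P.basis.constr_basis k _ p
  have hbasis : ∀ c b (hc : P.basis c ∈ C) (hb : P.basis b ∈ B), P.SourceMax c → P.TargetMax b →
      θ (P.basis c * P.basis b) = Submodule.Quotient.mk
        ((⟨P.basis c, hc⟩ : C) ⊗ₜ[k] (⟨P.basis b, hb⟩ : B)) := by
    intro c b hc hb hcm hbm
    by_cases hcb : P.tgt b = P.src c
    · obtain ⟨p, hp⟩ := (mul_cases _ _).resolve_left (h' c b hcm hbm hcb)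
      obtain ⟨h1, h2⟩ := h.left_right_eq hcm hbm hp
      rw [hp, hθ]
      congr 2
      · exact Subtype.ext (congrArg P.basis h1)
      · exact Subtype.ext (congrArg P.basis h2)
    · have h0 : P.basis c * P.basis b = 0 := by
        by_contra h0
        exact hcb (tgt_eq_src_of_mul_ne_zero h0)
      rw [h0, map_zero]
      symm
      rw [Submodule.Quotient.mk_eq_zero]
      -- For a pair that is not composable, `c ⊗ b = c e ⊗ b = c ⊗ e b = 0` with `e` the idempotent
      -- at the source of `c`.
      refine Submodule.subset_span ⟨e (P.src c), Submodule.subset_span ⟨_, rfl⟩,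
        ⟨P.basis c, hc⟩, ⟨P.basis c, hc⟩, ⟨P.basis b, hb⟩, 0, ?_, ?_, ?_⟩
      · exact (P.basis_mul_idem c).symm
      · exact (P.idem_mul_basis_of_ne hcb).symm
      · rw [TensorProduct.tmul_zero, sub_zero]
  have hright : ∀ c (hc : P.basis c ∈ C), P.SourceMax c → ∀ b : B,
      θ (P.basis c * b) = Submodule.Quotient.mk ((⟨P.basis c, hc⟩ : C) ⊗ₜ[k] b) := by
    intro c hc hcm
    suffices H : ∀ x (hx : x ∈ Submodule.span k (P.basis '' {p | P.TargetMax p})),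
        θ (P.basis c * x) = Submodule.Quotient.mk ((⟨P.basis c, hc⟩ : C) ⊗ₜ[k]
          (⟨x, (hB x).2 hx⟩ : B)) from fun b => H b ((hB b).1 b.2)
    intro x hx
    induction hx using Submodule.span_induction with
    | mem x hx =>
      obtain ⟨b, hb, rfl⟩ := hx
      exact hbasis c b hc _ hcm hb
    | zero =>
      rw [mul_zero, map_zero]
      exact (congrArg Submodule.Quotient.mk (TensorProduct.tmul_zero (N := B) _)).symm
    | add x y hx hy hx' hy' =>
      rw [mul_add, map_add, hx', hy', ← Submodule.Quotient.mk_add, ← TensorProduct.tmul_add]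
      rfl
    | smul a x hx hx' =>
      rw [mul_smul_comm, map_smul, hx', ← Submodule.Quotient.mk_smul, ← TensorProduct.tmul_smul]
      rfl
  have hall : ∀ (c : C) (b : B), θ ((c : R) * b) = Submodule.Quotient.mk (c ⊗ₜ[k] b) := by
    intro c b
    suffices H : ∀ x (hx : x ∈ Submodule.span k (P.basis '' {p | P.SourceMax p})),
        θ (x * b) = Submodule.Quotient.mk ((⟨x, (hC x).2 hx⟩ : C) ⊗ₜ[k] b) from
      H c ((hC c).1 c.2)
    intro x hx
    induction hx using Submodule.span_induction with
    | mem x hx =>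
      obtain ⟨c, hc, rfl⟩ := hx
      exact hright c _ hc b
    | zero =>
      rw [zero_mul, map_zero]
      exact (congrArg Submodule.Quotient.mk (TensorProduct.zero_tmul C b)).symm
    | add x y hx hy hx' hy' =>
      rw [add_mul, map_add, hx', hy', ← Submodule.Quotient.mk_add, ← TensorProduct.add_tmul]
      rfl
    | smul a x hx hx' =>
      rw [smul_mul_assoc, map_smul, hx', ← Submodule.Quotient.mk_smul,
        TensorProduct.smul_tmul']
      rfl
  refine ⟨?_, ?_, ?_, ?_⟩
  · refine Submodule.span_le.2 ?_
    rintro _ ⟨i, rfl⟩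
    exact (hC _).2 (idem_mem_span.2 (P.sourceMax_triv i))
  · refine Submodule.span_le.2 ?_
    rintro _ ⟨i, rfl⟩
    exact (hB _).2 (idem_mem_span.2 (P.targetMax_triv i))
  · have hinv : ∀ z, θ (relTensorMul (vertexSpan k e) C B z) = z := by
      intro z
      obtain ⟨w, rfl⟩ := Submodule.Quotient.mk_surjective _ z
      induction w using TensorProduct.induction_on with
      | zero => simp
      | tmul c b => rw [hmul, hall]
      | add x y hx hy => rw [Submodule.Quotient.mk_add, map_add, map_add, hx, hy]
    exact Function.LeftInverse.injective hinv
  · rw [← LinearMap.range_eq_top, eq_top_iff]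
    intro x _
    refine (span_le.2 ?_ : P.span Set.univ ≤ _) (mem_span_univ x)
    intro p _
    exact ⟨Submodule.Quotient.mk (cl p ⊗ₜ[k] br p), P.left_mul_right p⟩

/-! ### The `Δ`-subalgebra -/

section Delta

variable {C : Subalgebra k R} (hC : ∀ x, x ∈ C ↔ x ∈ P.span {p | P.SourceMax p})
include hC

theorem idem_mem_of_sourceMax (i : Fin n) : e i ∈ C :=
  (hC _).2 (idem_mem_span.2 (P.sourceMax_triv i))

theorem exists_smul_eq_standard [Finite ι] {i : Fin n} (x : standard R e i) : ∃ c : C,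
    c • (Submodule.Quotient.mk ⟨e i, Submodule.mem_span_singleton_self _⟩ : standard R e i) =
      x := by
  obtain ⟨a, rfl⟩ := Submodule.Quotient.mk_surjective _ x
  have h1 : P.span Set.univ ≤ P.span {p | P.SourceMax p} ⊔ P.span {p | ¬ P.SourceMax p} := by
    refine span_le.2 fun p _ => ?_
    by_cases hp : P.SourceMax p
    · exact Submodule.mem_sup_left (basis_mem_span.2 hp)
    · exact Submodule.mem_sup_right (basis_mem_span.2 hp)
  obtain ⟨y, hy, z, hz, hyz⟩ := Submodule.mem_sup.1 (h1 (mem_span_univ (a : R)))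
  refine ⟨⟨y, (hC y).2 hy⟩, ?_⟩
  change y • (Submodule.Quotient.mk _ : standard R e i) = _
  rw [← Submodule.Quotient.mk_smul, Submodule.Quotient.eq, P.mem_standardKernel_iff]
  change y * e i - a ∈ _
  rw [← P.isSplitBasic.mem_proj.1 a.2, ← hyz, add_mul, sub_add_cancel_left]
  exact Submodule.neg_mem _ (span_mono (fun p hp => hp.1) (mul_idem_mem hz i))

/-- The map `C e_i → Δ_i` given by acting on the generator is bijective: elements of `C` involve
only `SourceMax` paths and the standard kernel involves none. -/
theorem projective_standard [Finite ι] (i : Fin n) : Module.Projective C (standard R e i) := by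
  let ei : C := ⟨e i, idem_mem_of_sourceMax hC i⟩
  have hei : ei * ei = ei := Subtype.ext (P.idem_mul_self i)
  let δ : standard R e i := Submodule.Quotient.mk ⟨e i, Submodule.mem_span_singleton_self _⟩
  have hδ : ei • δ = δ := by
    change e i • (Submodule.Quotient.mk _ : standard R e i) = _
    rw [← Submodule.Quotient.mk_smul]
    congr 1
    exact Subtype.ext (P.idem_mul_self i)
  let s : Submodule.span C {ei} →ₗ[C] standard R e i :=
    (LinearMap.toSpanSingleton C _ δ).comp (Submodule.span C {ei}).subtype
  have := projective_span_idem hei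
  refine Module.Projective.of_equiv (LinearEquiv.ofBijective s ⟨?_, fun x => ?_⟩)
  · rw [← LinearMap.ker_eq_bot, LinearMap.ker_eq_bot']
    intro x hx
    obtain ⟨c, hc⟩ := Submodule.mem_span_singleton.1 x.2
    have hx : ((x : C) : R) • δ = 0 := hx
    have hxe : ((x : C) : R) * e i = (x : C) := by
      rw [← hc]
      change (c : R) * e i * e i = c * e i
      rw [mul_assoc, P.idem_mul_self]
    rw [← Submodule.Quotient.mk_smul, Submodule.Quotient.mk_eq_zero,
      P.mem_standardKernel_iff] at hx
    change ((x : C) : R) * e i ∈ _ at hx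
    rw [hxe, mem_span] at hx
    have hx' := mem_span.1 ((hC _).1 (x : C).2)
    refine Subtype.ext (Subtype.ext ((map_eq_zero_iff P.basis.repr P.basis.repr.injective).1
      (Finsupp.ext fun p => ?_)))
    by_contra h0
    exact hx p h0 (hx' p h0)
  · obtain ⟨c, rfl⟩ := exists_smul_eq_standard hC x
    refine ⟨⟨c * ei, Submodule.mem_span_singleton.2 ⟨c, rfl⟩⟩, ?_⟩
    change (c * ei) • δ = c • δ
    rw [mul_smul, hδ]

theorem isProjectiveCover_standard [Finite ι] (i : Fin n) :
    IsProjectiveCover C (standard R e i) (simple R e i) := by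
  refine ⟨projective_standard hC i, ?_⟩
  let ei : proj R e i := ⟨e i, Submodule.mem_span_singleton_self _⟩
  let δ : standard R e i := Submodule.Quotient.mk ei
  have hle : standardKernel R e i ≤ (Module.jacobson R (proj R e i)).comap LinearMap.id := by
    intro x hx
    rw [P.mem_standardKernel_iff, mem_span] at hx
    rw [Submodule.mem_comap, LinearMap.id_apply, P.isSplitBasic.mem_jacobson_proj, char_apply]
    by_contra h0
    exact hx _ h0 (P.sourceMax_triv i)
  let π : standard R e i →ₗ[R] simple R e i := Submodule.mapQ _ _ LinearMap.id hle
  refine ⟨π.restrictScalars C, fun x => ?_, fun N hN => ?_⟩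
  · obtain ⟨y, rfl⟩ := Submodule.Quotient.mk_surjective _ x
    exact ⟨Submodule.Quotient.mk y, rfl⟩
  · have hbasic := P.isSplitBasic_subalgebra C (idem_mem_of_sourceMax hC)
    suffices hδN : δ ∈ N by
      refine eq_top_iff.2 fun x _ => ?_
      obtain ⟨c, rfl⟩ := exists_smul_eq_standard hC x
      exact N.smul_mem c hδN
    have hδ : e i • δ = δ := by
      rw [← Submodule.Quotient.mk_smul]
      congr 1
      exact Subtype.ext (P.idem_mul_self i)
    obtain ⟨x, hx, y, hy, hxy⟩ := Submodule.mem_sup.1 (hN ▸ Submodule.mem_top : δ ∈ _)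
    obtain ⟨c, rfl⟩ := exists_smul_eq_standard hC y
    have hy : Submodule.Quotient.mk ((c : R) • ei) = (0 : simple R e i) := hy
    rw [Submodule.Quotient.mk_eq_zero, P.isSplitBasic.mem_jacobson_proj] at hy
    -- `d` acts on `δ` as `c` does, but it lies in the radical of `C`. Thus `1 - d` is a unit
    -- carrying `δ` to `x ∈ N`, which puts `δ` in `N`.
    let d : C := c * ⟨e i, idem_mem_of_sourceMax hC i⟩
    have hd : ∀ j, P.char j (d : R) = 0 := by
      intro j
      change P.char j ((c : R) * e i) = 0
      by_cases hj : j = i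
      · rw [hj]
        exact hy
      · rw [map_mul, P.char_idem, if_neg hj, mul_zero]
    have hdδ : d • δ = c • δ := by
      change ((c : R) * e i) • δ = (c : R) • δ
      rw [mul_smul, hδ]
    have hxd : (1 - d) • δ = x := by
      rw [sub_smul, one_smul, hdδ, sub_eq_iff_eq_add]
      exact hxy.symm
    obtain ⟨u, hu⟩ := hbasic.isUnit_one_sub (x := d) hd
    have : δ = (↑u⁻¹ : C) • x := by
      rw [← hxd, ← hu, smul_smul, Units.inv_mul, one_smul]
    rw [this]
    exact N.smul_mem _ hx

theorem isDeltaSubalgebra [Finite ι] : IsDeltaSubalgebra e C := by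
  have hR : ∀ i, IsCharModule (P.char i) (simple R e i) := P.isSplitBasic.isCharModule_simple
  have hS : ∀ i, IsCharModule ((P.char i).comp C.val) (simple R e i) :=
    fun i => (hR i).subalgebra C
  have hbasic := P.isSplitBasic_subalgebra C (idem_mem_of_sourceMax hC)
  refine ⟨fun i => simple R e i, fun _ => inferInstance, fun _ => inferInstance,
    fun _ => inferInstance, fun _ => inferInstance, ?_⟩
  exact
    { simples := hbasic.isSimpleList hS
      endSimple := fun i => by
        obtain ⟨f⟩ := (hS i).nonempty_end_equiv
        obtain ⟨g⟩ := (hR i).nonempty_end_equiv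
        exact ⟨f.trans g.symm⟩
      directed := fun i j hij => by
        by_contra hlt
        refine not_subsingleton_iff_nontrivial.2 hij (subsingleton_ext_of_idem (hS i) (hS j)
          (hbasic.idem i) (by rw [hbasic.apply, if_pos rfl]) (f := ⟨e j, _⟩)
          (by rw [hbasic.apply, if_pos rfl]) fun b => Subtype.ext ?_)
        refine idem_mul_mul_idem_eq_zero (fun p hp hpi hpj => hlt ?_) ((hC b).1 b.2)
        rw [← hpi, ← hpj]
        exact SourceMax.tgt_le hp
      restrict := isProjectiveCover_standard hC }

end Delta

theorem op_mem_span {T : Set ι} {x : R} : MulOpposite.op x ∈ P.op.span T ↔ x ∈ P.span T := by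
  have h : ∀ p, P.op.basis.repr (MulOpposite.op x) p = P.basis.repr x p := fun p => by
    simp [PathBasis.op]
  simp only [mem_span, h]

end PathBasis

end QHMonomial

end

/-! ### The theorem for monomial algebras. -/

open QHMonomial in
theorem theorem3p6 {k : Type u} [Field k] {V : Type v} [Quiver.{w + 1} V] [Fintype V]
    [∀ a b : V, Finite (a ⟶ b)] {n : ℕ} (ν : Fin n ≃ V) (X : Set (QPath V))
    (hX : IsAdmissible k X)
    (hA : IsQuasiHereditary (MonomialAlgebra k X) (vertexIdem k X ν) k) :
    IsExactBorel (fun i => MulOpposite.op (vertexIdem k X ν i)) (Cmin k X ν) ∧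
    IsDeltaSubalgebra (vertexIdem k X ν) (Cmin k X ν).unop ∧
    IsExactBorel (vertexIdem k X ν) (Bmin k X ν) ∧
    IsReedyDecomposition (vertexSpan k (vertexIdem k X ν)) (Cmin k X ν).unop (Bmin k X ν) := by
  have := finite_nonzeroPath k hX
  let P := monomialPathBasis k ν hX.1
  have h : P.NoReturn := fun p hp ht => P.len_eq_zero_of_end hA.endStandard hp ht
  have h' : P.ProductsNonzero := fun c b hc hb hcb =>
    P.mul_ne_zero_of_filtered h hA.filtered hc hb hcb
  have hpaths : pathsIn k X = Set.range P.basis := by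
    ext x
    constructor
    · rintro ⟨p, hp, rfl⟩
      exact ⟨⟨p, hp⟩, monomialPathBasis_basis k ν hX.1 ⟨p, hp⟩⟩
    · rintro ⟨p, rfl⟩
      exact ⟨p.1, p.2, monomialPathBasis_basis k ν hX.1 p⟩
  have hpaths' : MulOpposite.op '' pathsIn k X = Set.range P.op.basis := by
    rw [hpaths, ← Set.range_comp]
    congr 1
  have hB : ∀ x, x ∈ Bmin k X ν ↔ x ∈ P.span {p | P.TargetMax p} := fun x => by
    rw [Bmin, hpaths, h.mem_minSubalgebra_iff]
  have hCop : ∀ x, x ∈ Cmin k X ν ↔ x ∈ P.op.span {p | P.op.TargetMax p} := fun x => by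
    rw [Cmin, hpaths', h.op.mem_minSubalgebra_iff]
  have hC : ∀ x, x ∈ (Cmin k X ν).unop ↔ x ∈ P.span {p | P.SourceMax p} := fun x => by
    rw [Subalgebra.mem_unop, hCop, PathBasis.op_mem_span]
    simp only [PathBasis.op_targetMax]
  exact ⟨PathBasis.isExactBorel h.op h'.op hCop, PathBasis.isDeltaSubalgebra hC,
    PathBasis.isExactBorel h h' hB, PathBasis.isReedyDecomposition h h' hC hB⟩
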